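/- Let $p>q$ be primes, $k\ge 1$, $n=kq+1$, and assume $p>n$. Let $\tilde\Lambda=(\tilde\Lambda_1,\dots,\tilde\Lambda_{\tilde n})$ be integers with $0<\tilde\Lambda_j<q$ and $\sum_j\tilde\Lambda_j=n$ (i.e. $\tilde\Lambda$ is a fusion of $(1,\dots,1)\in\mathbb Z^n$). Let $a_1$ be the integer with $1\le a_1<q$ and $q\mid a_1p-1$. For $1\le a<q$ put $e_j(a)=\lceil(\tilde\Lambda_ja+1)/q-1\rceil$ and $e(a)=\sum_je_j(a)$. Let $\mathbb K=\mathbb K(\tilde z)$ be the perfect closure of $\mathbb F_p(\tilde z_1,\dots,\tilde z_{\tilde n})$, $\sigma(c)=c^p$ and $\tau=\sigma^{-1}$. Let $\tilde X$ be the smooth projective curve over $\mathbb K$ given by $y^q=\prod_j(x-\tilde z_j)^{\tilde\Lambda_j}$. Let $\Omega^1_a(\tilde X)$ be the space of regular differentials on $\tilde X$ of the form $u(x)\,dx/y^a$ with $u\in\mathbb K(x)$, and let $W(\tilde X)$ be the $\mathbb K$-span of the differentials $w_j=\frac{1}{x-\tilde z_j}\frac{dx}{y}$, $j=1,\dots,\tilde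 n$. For a vector $M=(M_1,\dots,M_{\tilde n})$ of positive integers let $P^i(\tilde z,M)\in\mathbb F_p[\tilde z]^{\tilde n}$ be the vectors of coefficients in $$\prod_i(t-\tilde z_i)^{M_i}\Big(\tfrac1{t-\tilde z_1},\dots,\tfrac1{t-\tilde z_{\tilde n}}\Big)=\sum_iP^i(\tilde z,M)\,t^i .$$ Call $M$ admissible if $M_j\equiv-\tilde\Lambda_j/q \pmod p$ for all $j$. The module of arithmetic solutions $\mathcal M_{\tilde\Lambda}$ is the $\mathbb F_p[\tilde z^p]$-submodule of $\mathbb F_p[\tilde z]^{\tilde n}$ spanned by the $P^{lp-1}(\tilde z,M)$, $l\ge1$, where $\mathbb F_p[\tilde z^p]=\mathbb F_p[\tilde z_1^p,\dots,\tilde z_{\tilde n}^p]$ and $M$ is any admissible vector. Put $\tilde M_j=\tilde\Lambda_j(a_1p-1)/q$. **Theorem.** The vector $\tilde M$ is admissible, and the $w_j$ form a basis of $W(\tilde X)$; let $(\psi_j)$ be the dual basis of $W(\tilde X)^*$. The $\tau$-linear Cartier map $\hat C$ on $W(\tilde X)$, defined by $$\hat C(w_j)=\sum_{l=0}^{a_1k-1}\big(P_j^{lp+p-1}(\tilde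 z,\tilde M)\big)^{1/p}\,x^l\,\frac{dx}{y^{a_1}},$$ takes values in $\Omega^1_{a_1}(\tilde X)$. Every element of $\Omega^1_{a_1}(\tilde X)$ is uniquely of the form $\sum_{i=0}^{a_1k-1}u^ix^i\,dx/y^{a_1}$ with $u^i\in\mathbb K$; let $\phi^m\in\Omega^1_{a_1}(\tilde X)^*$, $0\le m<a_1k$, send it to $u^m$. Let $\hat C^*:\Omega^1_{a_1}(\tilde X)^*\to W(\tilde X)^*$ be the $\sigma$-linear adjoint, $(w,\hat C^*\xi)=(\hat Cw,\xi)^p$, and let $\iota(\xi)\in\mathbb K^{\tilde n}$ be the coordinate vector of $\hat C^*\xi$ in the basis $(\psi_j)$. Then: 1. $\iota(\phi^m)=P^{mp+p-1}(\tilde z,\tilde M)$ for $0\le m<a_1k$. 2. For every choice of admissible $M$ in the definition of $\mathcal M_{\tilde\Lambda}$, $\iota$ defines an isomorphism of $\Omega^1_{a_1}(\tilde X)^*$ and $\mathcal M_{\tilde\Lambda}$ in the following sense: the $\sigma$-linear map $\iota$ is injective, its image is the $\mathbb K$-span of $\mathcal M_{\tilde\Lambda}$, and it restricts to a bijection of the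 $\mathbb F_p[\tilde z]$-span of the $\phi^m$ onto $\mathcal M_{\tilde\Lambda}$ (which is semilinear with respect to the isomorphism $c\mapsto c^p$ of $\mathbb F_p[\tilde z]$ and $\mathbb F_p[\tilde z^p]$). 3. $\dim_{\mathbb K}\Omega^1_{a_1}(\tilde X)^*=a_1k-e(a_1)$, and $\mathcal M_{\tilde\Lambda}$ is a free $\mathbb F_p[\tilde z^p]$-module of finite rank $a_1k-e(a_1)$. -/

import Mathlib

open scoped KaehlerDifferential

namespace ArithKZ

noncomputable section

/-! ### Regular differentials on the smooth projective curve with a given function field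

The closed points of the smooth projective curve with function field `L / K` are the nontrivial
valuation rings of `L` containing `K`. -/

section Curve

variable (K : Type*) [Field K] (L : Type*) [Field L] [Algebra K L]

/-- The differential `ω` of `L / K` is regular at the point with local ring `O`: it is an
`O`-linear combination of differentials `df`, `f ∈ O`. -/
def IsRegularAt (O : ValuationSubring L) (ω : Ω[L⁄K]) : Prop :=
  ω ∈ Submodule.span O (KaehlerDifferential.D K L '' (O : Set L))

/-- `Ω¹(X)`: the `K`-space of differentials which are regular at every point of the curve. (The
trivial valuation ring `O = L` imposes no condition.) -/
def regularForms : Submodule K Ω[L⁄K] where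
  carrier := {ω | ∀ O : ValuationSubring L, (∀ c : K, algebraMap K L c ∈ O) → IsRegularAt K L O ω}
  add_mem' ha hb O hO := Submodule.add_mem _ (ha O hO) (hb O hO)
  zero_mem' O _ := Submodule.zero_mem _
  smul_mem' c ω h O hO := by
    have := Submodule.smul_mem _ (⟨algebraMap K L c, hO c⟩ : O) (h O hO)
    have e : (⟨algebraMap K L c, hO c⟩ : O) • ω = c • ω := by
      change (algebraMap K L c) • ω = c • ω
      rw [algebraMap_smul]
    rw [e] at this
    exact this

variable [Algebra (RatFunc K) L] [IsScalarTower K (RatFunc K) L]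

/-- The differential `u(x) dx / y ^ a`, as a `K`-linear function of the rational function `u`. -/
def diffForm (y : L) (a : ℕ) : RatFunc K →ₗ[K] Ω[L⁄K] where
  toFun u := (algebraMap (RatFunc K) L u * (y ^ a)⁻¹) •
    KaehlerDifferential.D K L (algebraMap (RatFunc K) L RatFunc.X)
  map_add' u v := by rw [map_add, add_mul, add_smul]
  map_smul' c u := by
    rw [Algebra.smul_def, map_mul, ← IsScalarTower.algebraMap_apply, mul_assoc, mul_smul,
      algebraMap_smul, RingHom.id_apply]

/-- `Ω¹_a(X)`: the regular differentials of the form `u(x) dx / y ^ a` with `u ∈ K(x)`. -/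
def regularFormsOfType (y : L) (a : ℕ) : Submodule K Ω[L⁄K] :=
  regularForms K L ⊓ LinearMap.range (diffForm K L y a)

end Curve

/-! ### Semilinear algebra -/

section Adjoint

variable {K : Type*} [Field K] (p : ℕ) [ExpChar K p] [PerfectRing K p]

/-- The inverse Frobenius `τ : c ↦ c ^ (1 / p)` of a perfect field. -/
abbrev invFrobenius (K : Type*) [Field K] (p : ℕ) [ExpChar K p] [PerfectRing K p] : K →+* K :=
  ((frobeniusEquiv K p).symm : K →+* K)

variable {W V : Type*} [AddCommGroup W] [Module K W] [AddCommGroup V] [Module K V]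

/-- The adjoint of a `τ`-linear map `f : W → V`, where `τ` is the inverse Frobenius: the `σ`-linear
map `f* : V* → W*`, `(w, f* ξ) = (f w, ξ) ^ σ`, where `σ` is the Frobenius. -/
def adjointMap (f : W →ₛₗ[invFrobenius K p] V) :
    Module.Dual K V →ₛₗ[frobenius K p] Module.Dual K W where
  toFun ξ :=
    { toFun := fun w => frobenius K p (ξ (f w))
      map_add' := fun v w => by simp only [map_add]
      map_smul' := fun c w => by
        rw [LinearMap.map_smulₛₗ, map_smul, smul_eq_mul, map_mul, RingHom.coe_coe,
          frobenius_apply_frobeniusEquiv_symm, RingHom.id_apply, smul_eq_mul] }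
  map_add' ξ η := by
    ext w
    simp
  map_smul' c ξ := by
    ext w
    simp

end Adjoint

/-! ### The module of arithmetic solutions -/

section Solutions

variable (p : ℕ) {n : ℕ}

/-- The subring `𝔽_p[z^p] = 𝔽_p[z_1^p, …, z_n^p]` of `𝔽_p[z]`. -/
abbrev PolyZp (p n : ℕ) : Subalgebra (ZMod p) (MvPolynomial (Fin n) (ZMod p)) :=
  Algebra.adjoin (ZMod p) (Set.range fun i => MvPolynomial.X i ^ p)

/-- The master polynomial `Φ_p(t, z, M) = ∏ (t - z_i) ^ M_i`, a polynomial in `t` over `𝔽_p[z]`. -/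
def masterPoly (M : Fin n → ℕ) : Polynomial (MvPolynomial (Fin n) (ZMod p)) :=
  ∏ i, (Polynomial.X - Polynomial.C (MvPolynomial.X i)) ^ M i

/-- `P^i(z, M) ∈ 𝔽_p[z]^n`: its coordinate `P^i_j(z, M)` is the coefficient of `t ^ i` in the
polynomial `Φ_p(t, z, M) / (t - z_j)` (the division is exact when `M_j > 0`). -/
def solVec (M : Fin n → ℕ) (i : ℕ) : Fin n → MvPolynomial (Fin n) (ZMod p) :=
  fun j => (masterPoly p M /ₘ (Polynomial.X - Polynomial.C (MvPolynomial.X j))).coeff i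

/-- The module `𝓜_M`: the `𝔽_p[z^p]`-submodule of `𝔽_p[z]^n` spanned by the vectors
`P^{lp-1}(z, M)`, `l = 1, 2, …`. -/
def solModule (M : Fin n → ℕ) : Submodule (PolyZp p n) (Fin n → MvPolynomial (Fin n) (ZMod p)) :=
  Submodule.span (PolyZp p n) {v | ∃ l : ℕ, 0 < l ∧ v = solVec p M (l * p - 1)}

instance (M : Fin n → ℕ) : Module (PolyZp p n) (solModule p M) :=
  Submodule.module _

/-- `M` is a vector of positive integers with `M_j ≡ - Λ_j / q` modulo `p`. -/
def IsAdmissible [Fact p.Prime] (q : ℕ) (Λ M : Fin n → ℕ) : Prop :=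
  ∀ j, 0 < M j ∧ (M j : ZMod p) = -((Λ j : ZMod p) / (q : ZMod p))

end Solutions

/-! ### The curve `y ^ q = ∏ (x - z_j) ^ Λ_j` over `𝕂(z)` -/

section Superelliptic

/-- The field `𝕂(z)` of rational functions over `𝔽_p` in all `z_j ^ (1 / p ^ s)`, that is, the
perfect closure of `𝔽_p(z_1, …, z_n)`. -/
abbrev FieldK (p n : ℕ) [Fact p.Prime] : Type :=
  PerfectClosure (FractionRing (MvPolynomial (Fin n) (ZMod p))) p

variable (p q : ℕ) [Fact p.Prime] [Fact q.Prime] {n : ℕ}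

/-- The inclusion `𝔽_p[z] → 𝕂(z)`. -/
def toK (n : ℕ) : MvPolynomial (Fin n) (ZMod p) →+* FieldK p n :=
  (PerfectClosure.of (FractionRing (MvPolynomial (Fin n) (ZMod p))) p).comp
    (algebraMap (MvPolynomial (Fin n) (ZMod p)) (FractionRing (MvPolynomial (Fin n) (ZMod p))))

/-- The element `x - z_j` of `𝕂(z)(x)`. -/
def xSub (j : Fin n) : RatFunc (FieldK p n) :=
  RatFunc.X - RatFunc.C (toK p n (MvPolynomial.X j))

/-- `F(x, z) = ∏ (x - z_j) ^ Λ_j`. -/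
def curvePoly (Λ : Fin n → ℕ) : RatFunc (FieldK p n) :=
  ∏ j, xSub p j ^ Λ j

/-- A root of `Y ^ q = F(x, z)` in an algebraic closure of `𝕂(z)(x)`. -/
def rootY (Λ : Fin n → ℕ) : AlgebraicClosure (RatFunc (FieldK p n)) :=
  (IsAlgClosed.exists_pow_nat_eq
    (algebraMap (RatFunc (FieldK p n)) (AlgebraicClosure (RatFunc (FieldK p n))) (curvePoly p Λ))
    (Fact.out : q.Prime).pos).choose

/-- The function field `𝕂(z)(x)(y)` of the curve `y ^ q = F(x, z)`. -/
def FunField (Λ : Fin n → ℕ) : Type :=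
  IntermediateField.adjoin (RatFunc (FieldK p n)) {rootY p q Λ}

instance (Λ : Fin n → ℕ) : Field (FunField p q Λ) :=
  inferInstanceAs (Field (IntermediateField.adjoin (RatFunc (FieldK p n)) {rootY p q Λ}))

instance (Λ : Fin n → ℕ) : Algebra (RatFunc (FieldK p n)) (FunField p q Λ) :=
  inferInstanceAs (Algebra (RatFunc (FieldK p n))
    (IntermediateField.adjoin (RatFunc (FieldK p n)) {rootY p q Λ}))

instance (Λ : Fin n → ℕ) : Algebra (FieldK p n) (FunField p q Λ) :=
  ((algebraMap (RatFunc (FieldK p n)) (FunField p q Λ)).comp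
    (algebraMap (FieldK p n) (RatFunc (FieldK p n)))).toAlgebra

instance (Λ : Fin n → ℕ) : IsScalarTower (FieldK p n) (RatFunc (FieldK p n)) (FunField p q Λ) :=
  IsScalarTower.of_algebraMap_eq (R := FieldK p n) (S := RatFunc (FieldK p n))
    (A := FunField p q Λ) fun _ => rfl

/-- The function `y` on the curve. -/
def coordY (Λ : Fin n → ℕ) : FunField p q Λ :=
  IntermediateField.AdjoinSimple.gen (RatFunc (FieldK p n)) (rootY p q Λ)

theorem coordY_pow (Λ : Fin n → ℕ) :
    coordY p q Λ ^ q = algebraMap (RatFunc (FieldK p n)) (FunField p q Λ) (curvePoly p Λ) := by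
  apply Subtype.ext
  exact (IsAlgClosed.exists_pow_nat_eq
    (algebraMap (RatFunc (FieldK p n)) (AlgebraicClosure (RatFunc (FieldK p n))) (curvePoly p Λ))
    (Fact.out : q.Prime).pos).choose_spec

/-- The space of all differential 1-forms on the curve (regular or not). -/
abbrev Forms (Λ : Fin n → ℕ) : Type :=
  Ω[FunField p q Λ⁄FieldK p n]

/-- The differential `u(x) dx / y ^ a` on the curve. -/
def form (Λ : Fin n → ℕ) (a : ℕ) (u : RatFunc (FieldK p n)) : Forms p q Λ :=
  diffForm (FieldK p n) (FunField p q Λ) (coordY p q Λ) a u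

/-- `Ω¹_a(X)`, the space of regular differentials of the form `u(x) dx / y ^ a`. -/
abbrev OmegaA (Λ : Fin n → ℕ) (a : ℕ) : Submodule (FieldK p n) (Forms p q Λ) :=
  regularFormsOfType (FieldK p n) (FunField p q Λ) (coordY p q Λ) a

/-- `W(X)`, the span of the differentials `dx / (y (x - z_j))`. -/
abbrev SpaceW (Λ : Fin n → ℕ) : Submodule (FieldK p n) (Forms p q Λ) :=
  Submodule.span (FieldK p n) (Set.range fun j : Fin n => form p q Λ 1 (xSub p j)⁻¹)

end Superelliptic

/-- `e(a) = ∑ e_j(a)`, where `e_j(a) = ⌈(Λ_j a + 1) / q - 1⌉`. -/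
def eSum (q : ℕ) {n : ℕ} (Λ : Fin n → ℕ) (a : ℕ) : ℤ :=
  ∑ j, ⌈((Λ j : ℚ) * a + 1) / q - 1⌉

/-- `M̃_j = Λ_j (a p - 1) / q`. -/
def tildeM (p q : ℕ) {n : ℕ} (Λ : Fin n → ℕ) (a : ℕ) : Fin n → ℕ :=
  fun j => Λ j * ((a * p - 1) / q)

end

end ArithKZ

open scoped KaehlerDifferential

namespace ArithKZ

open Polynomial

/-! The map `decim`, which keeps the coefficients of index `l p + p - 1`, is the Cartier operator on
polynomial differentials up to a Frobenius twist: it kills derivatives and turns a factor `g(x ^ p)`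
into `g(x)`. The coordinates of the arithmetic solutions are the coefficients of the decimated
polynomials `Φ / (x - z_j)`, and these polynomials, untwisted by the inverse Frobenius, are the
numerators of the differentials `Ĉ(w_j)`. The formula for `ι(φ^m)` is then immediate; the substance
lies in regularity and surjectivity of `Ĉ` and in the rank count.

Write `e_j = ⌊Λ_j a / q⌋` and `M̃_j = m_j + p e_j`. Arithmetic gives `0 < m_j < p` and `∑ m_j = d p
+ r` with `0 ≤ r < p` and `d = a k - e(a)`. The factor of exponent `p e_j` passes through the
decimation as `(x - z_j ^ p) ^ e_j`. After untwisting, `Ĉ(w_j)` has numerator `∏ (x - z_i) ^ e_i`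
times a polynomial of degree less than `d` (`solPoly_tildeM`). These products are exactly the
numerators of `Ω¹_a`, by `diffForm_mem_regularForms_iff`. The restrictive half of that criterion
tests a differential against Euler derivations, which preserve valuation rings
(`valuation_euler_lt_one`); the other half computes with an explicit uniformizer at the ramified
points (`isRegularAt_of_ramified`).

Surjectivity of `Ĉ` is `exists_sum_decim_eq`: a polynomial lifting the target is integrated locally
at each `z_i` and the primitives are glued by the Chinese remainder theorem, so that modulo a
derivative the lift is a combination of the `Φ / (x - z_j)`. Hence the adjoint is injective, and
dually the `d` solution vectors for the exponents `m` are linearly independent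
(`eq_zero_of_sum_coeff_decim_eq_zero`). They also span the module: changing an admissible vector by
multiples of `p` multiplies the decimated polynomials by a monic polynomial over `𝔽_p[z ^ p]`, which
preserves the span of coefficients (`span_coeff_monic_mul`). -/

/-! ### Decimation of polynomials -/

section Decim

variable {R S : Type*} [CommRing R] [CommRing S] (p : ℕ)

/-- The polynomial `∑ f_{lp+p-1} X ^ l`. -/
noncomputable def decim (f : R[X]) : R[X] := divX (contract p (X * f))

variable {p}

theorem coeff_decim (hp : 0 < p) (f : R[X]) (l : ℕ) :
    (decim p f).coeff l = f.coeff (l * p + p - 1) := by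
  rw [decim, coeff_divX, coeff_contract hp.ne']
  obtain ⟨r, rfl⟩ : ∃ r, p = r + 1 := ⟨p - 1, by omega⟩
  have : (l + 1) * (r + 1) = (l * (r + 1) + (r + 1) - 1) + 1 := by
    rw [add_one_mul]; omega
  rw [this, coeff_X_mul]

theorem decim_sub (hp : 0 < p) (f g : R[X]) : decim p (f - g) = decim p f - decim p g := by
  ext l; simp [coeff_decim hp]

theorem decim_sum (hp : 0 < p) {ι : Type*} (s : Finset ι) (f : ι → R[X]) :
    decim p (∑ i ∈ s, f i) = ∑ i ∈ s, decim p (f i) := by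
  ext l; simp [coeff_decim hp]

theorem decim_C_mul (hp : 0 < p) (c : R) (f : R[X]) : decim p (C c * f) = C c * decim p f := by
  ext l; simp [coeff_decim hp]

theorem decim_map (hp : 0 < p) (φ : R →+* S) (f : R[X]) :
    decim p (f.map φ) = (decim p f).map φ := by
  ext l; simp [coeff_decim hp]

theorem X_mul_decim (hp : 0 < p) (f : R[X]) : X * decim p f = contract p (X * f) := by
  have := divX_mul_X_add (contract p (X * f))
  rw [coeff_contract hp.ne', zero_mul, coeff_X_mul_zero, C_0, add_zero] at this
  rw [decim, mul_comm, this]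

/-- This is the `p`-inverse linearity of the Cartier operator, with the Frobenius twist on
coefficients left out. -/
theorem decim_expand_mul (hp : 0 < p) (g f : R[X]) :
    decim p (expand R p g * f) = g * decim p f := by
  apply (isRegular_X (R := R)).left
  change X * _ = X * _
  rw [X_mul_decim hp, mul_left_comm X g, X_mul_decim hp, mul_comm g,
    ← contract_mul_expand hp.ne', mul_left_comm, mul_comm]

/-- The retained coefficients of a derivative carry the factor `(l + 1) p`: exact differentials lie
in the kernel of the Cartier operator. -/
theorem decim_derivative [CharP R p] (hp : 0 < p) (f : R[X]) : decim p (derivative f) = 0 := by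
  ext l
  rw [coeff_decim hp, coeff_derivative]
  have h : l * p + p - 1 + 1 = (l + 1) * p := by rw [add_one_mul]; omega
  have : ((l * p + p - 1 : ℕ) : R) + 1 = 0 := by
    rw [← Nat.cast_add_one, h, Nat.cast_mul, CharP.cast_eq_zero R p, mul_zero]
  rw [this, mul_zero, coeff_zero]

theorem decim_expand_mul_X_pow (hp : 0 < p) (g : R[X]) :
    decim p (expand R p g * X ^ (p - 1)) = g := by
  rw [decim_expand_mul hp]
  have : decim p (X ^ (p - 1) : R[X]) = 1 := by
    ext l
    rw [coeff_decim hp, coeff_X_pow, coeff_one]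
    refine if_congr ?_ rfl rfl
    rcases Nat.eq_zero_or_pos l with rfl | hl
    · simp
    · have : p ≤ l * p := Nat.le_mul_of_pos_left p hl
      omega
  rw [this, mul_one]

end Decim

/-! ### Surjectivity of the Cartier operator -/

section Surjectivity

variable {K : Type*} [Field K] {p : ℕ} [CharP K p]

/-- Integration modulo `(X - a) ^ r`, `r < p`. -/
theorem exists_pow_dvd_sub_derivative (H : K[X]) (a : K) (r : ℕ) (hr : r < p) :
    ∃ f : K[X], (X - C a) ^ r ∣ H - derivative f := by
  induction r with
  | zero => exact ⟨0, by simp⟩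
  | succ r ih =>
    obtain ⟨f, g, hg⟩ := ih (by omega)
    have hr0 : ((r + 1 : ℕ) : K) ≠ 0 := by
      rw [Ne, CharP.cast_eq_zero_iff K p]
      exact fun h => absurd (Nat.le_of_dvd (by omega) h) (by omega)
    -- The added term is a primitive of the lowest term `g(a) (X - a) ^ r` of the remainder; `r + 1`
    -- is invertible because it is less than `p`.
    refine ⟨f + C (g.eval a / ((r + 1 : ℕ) : K)) * (X - C a) ^ (r + 1), ?_⟩
    obtain ⟨h, hh⟩ := dvd_iff_isRoot.mpr (show (g - C (g.eval a)).IsRoot a by simp)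
    refine ⟨h, ?_⟩
    have e : derivative (C (g.eval a / ((r + 1 : ℕ) : K)) * (X - C a) ^ (r + 1)) =
        C (g.eval a) * (X - C a) ^ r := by
      rw [derivative_C_mul, derivative_X_sub_C_pow, Nat.add_sub_cancel,
        ← mul_assoc, ← C_mul, div_mul_cancel₀ _ hr0]
    rw [derivative_add, e, ← sub_sub, hg, pow_succ, mul_assoc, ← hh]
    ring

theorem isCoprime_X_sub_C_pow {ι : Type*} {z : ι → K} (hz : Function.Injective z) (m : ι → ℕ)
    {i j : ι} (h : i ≠ j) :
    IsCoprime ((X - C (z i)) ^ m i) ((X - C (z j)) ^ m j) :=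
  (pairwise_coprime_X_sub_C hz h).pow

variable {ι : Type*} [Fintype ι] [DecidableEq ι] {z : ι → K}

theorem prod_X_sub_C_pow_divByMonic {R : Type*} [CommRing R] (z : ι → R) {m : ι → ℕ}
    (hm : ∀ i, 0 < m i) (j : ι) :
    (∏ i, (X - C (z i)) ^ m i) /ₘ (X - C (z j)) =
      (∏ i, (X - C (z i)) ^ (m i - 1)) * ∏ i ∈ Finset.univ.erase j, (X - C (z i)) := by
  have : ∏ i, (X - C (z i)) ^ m i = (X - C (z j)) * ((∏ i, (X - C (z i)) ^ (m i - 1)) *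
      ∏ i ∈ Finset.univ.erase j, (X - C (z i))) := by
    rw [mul_left_comm, Finset.mul_prod_erase _ (fun i => X - C (z i)) (Finset.mem_univ j),
      ← Finset.prod_mul_distrib]
    refine Finset.prod_congr rfl fun i _ => ?_
    rw [← pow_succ, Nat.sub_add_cancel (hm i)]
  rw [this, mul_divByMonic_cancel_left _ (monic_X_sub_C _)]

theorem exists_eq_sum_prod_erase (hz : Function.Injective z) (h : K[X])
    (hh : h.degree < Fintype.card ι) :
    ∃ c : ι → K, h = ∑ j, C (c j) * ∏ i ∈ Finset.univ.erase j, (X - C (z i)) := by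
  have := Lagrange.eq_interpolate (s := Finset.univ) (v := z) hz.injOn (f := h)
    (by rwa [Finset.card_univ])
  rw [Lagrange.interpolate_apply] at this
  refine ⟨fun j => h.eval (z j) * ∏ i ∈ Finset.univ.erase j, (z j - z i)⁻¹, ?_⟩
  conv_lhs => rw [this]
  refine Finset.sum_congr rfl fun j _ => ?_
  simp only [Lagrange.basis, Lagrange.basisDivisor, Finset.prod_mul_distrib, C_mul, map_prod,
    mul_assoc]

/-- Surjectivity of the Cartier operator within the degree bound. The lift `H = Q(X ^ p) X ^ (p -
1)` decimates to `Q`. Subtracting a derivative, which decimation ignores, makes it divisible by `∏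
(X - z_i) ^ (m_i - 1)`; the quotient has degree less than the number of points, so Lagrange
interpolation expands it in the products omitting one factor. -/
theorem exists_sum_decim_eq [Fact p.Prime] (hz : Function.Injective z) {m : ι → ℕ}
    (hm : ∀ i, 0 < m i ∧ m i ≤ p) (Q : K[X]) (hQ : ∀ l, ∑ i, m i < l * p + p → Q.coeff l = 0) :
    ∃ c : ι → K,
      ∑ j, C (c j) * decim p ((∏ i, (X - C (z i)) ^ m i) /ₘ (X - C (z j))) = Q := by
  have hp : 0 < p := (Fact.out : p.Prime).pos
  set H : K[X] := expand K p Q * X ^ (p - 1) with hH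
  set Φ : K[X] := ∏ i, (X - C (z i)) ^ m i with hΦ
  have hΦm : Φ.Monic := monic_prod_of_monic _ _ fun i _ => (monic_X_sub_C _).pow _
  have hΦd : Φ.natDegree = ∑ i, m i := by
    rw [hΦ, natDegree_prod_of_monic _ _ fun i _ => (monic_X_sub_C _).pow _]
    simp
  -- The bound `m i ≤ p` is what permits integration to order `m i - 1 < p`.
  choose F hF using fun i => exists_pow_dvd_sub_derivative (p := p) H (z i) (m i - 1)
    (by have := hm i; omega)
  -- The local primitives are glued modulo `(X - z_i) ^ m_i`, one order more than needed since
  -- differentiation loses one. Reducing the result modulo `Φ` keeps these congruences and bounds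
  -- its degree.
  obtain ⟨f₀, hf₀⟩ := Ideal.exists_forall_sub_mem_ideal
    (I := fun i => Ideal.span {(X - C (z i)) ^ m i})
    (fun i j h => (Ideal.isCoprime_span_singleton_iff _ _).mpr (isCoprime_X_sub_C_pow hz m h)) F
  have hdvd : ∀ i, (X - C (z i)) ^ m i ∣ f₀ %ₘ Φ - F i := by
    intro i
    have h1 := Ideal.mem_span_singleton.mp (hf₀ i)
    have h2 : (X - C (z i)) ^ m i ∣ Φ :=
      Finset.dvd_prod_of_mem (fun i => (X - C (z i)) ^ m i) (Finset.mem_univ i)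
    have h3 : f₀ %ₘ Φ - F i = (f₀ - F i) - Φ * (f₀ /ₘ Φ) := by
      have := modByMonic_add_div f₀ Φ
      linear_combination this
    rw [h3]
    exact dvd_sub h1 (h2.mul_right _)
  obtain ⟨h, hh⟩ : ∏ i, (X - C (z i)) ^ (m i - 1) ∣ H - derivative (f₀ %ₘ Φ) := by
    refine Finset.prod_dvd_of_coprime
      (fun i _ j _ hij => isCoprime_X_sub_C_pow hz (fun i => m i - 1) hij) fun i _ => ?_
    have h1 := pow_sub_one_dvd_derivative_of_pow_dvd (hdvd i)
    rw [derivative_sub] at h1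
    have h3 : H - derivative (f₀ %ₘ Φ) =
      (H - derivative (F i)) - (derivative (f₀ %ₘ Φ) - derivative (F i)) := by ring
    rw [h3]
    exact dvd_sub (hF i) h1
  have hΦ0 : (∏ i, (X - C (z i)) ^ (m i - 1)).Monic :=
    monic_prod_of_monic _ _ fun i _ => (monic_X_sub_C _).pow _
  have hΦ0d : (∏ i, (X - C (z i)) ^ (m i - 1)).natDegree + Fintype.card ι = ∑ i, m i := by
    rw [natDegree_prod_of_monic _ _ fun i _ => (monic_X_sub_C _).pow _]
    simp only [natDegree_pow, natDegree_X_sub_C, mul_one]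
    rw [← Finset.card_univ, Finset.card_eq_sum_ones, ← Finset.sum_add_distrib]
    exact Finset.sum_congr rfl fun i _ => Nat.sub_add_cancel (hm i).1
  have hdeg : (H - derivative (f₀ %ₘ Φ)).degree < (∑ i, m i : ℕ) := by
    refine (degree_sub_le _ _).trans_lt (max_lt ?_ ?_)
    -- The nonzero coefficients of `H` sit at `s = l p + p - 1`, so `s ≥ ∑ m_i` is exactly the range
    -- in which `hQ` makes them vanish.
    · refine (degree_lt_iff_coeff_zero _ _).mpr fun s hs => ?_
      rw [hH, coeff_mul_X_pow']
      split_ifs with hps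
      · rw [coeff_expand hp]
        split_ifs with hd
        · obtain ⟨l, hl⟩ := hd
          rw [hl, Nat.mul_div_cancel_left _ hp]
          apply hQ
          rw [mul_comm l]
          omega
        · rfl
      · rfl
    · refine (degree_derivative_le).trans_lt ?_
      rw [← hΦd, ← degree_eq_natDegree hΦm.ne_zero]
      exact degree_modByMonic_lt _ hΦm
  have hhd : h.degree < Fintype.card ι := by
    by_cases h0 : h = 0
    · simp [h0]
    rw [hh, degree_mul, degree_eq_natDegree hΦ0.ne_zero, degree_eq_natDegree h0, ← Nat.cast_add,
      Nat.cast_lt] at hdeg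
    rw [degree_eq_natDegree h0, Nat.cast_lt]
    omega
  obtain ⟨c, hc⟩ := exists_eq_sum_prod_erase hz h hhd
  refine ⟨c, ?_⟩
  have := congrArg (decim p) hh
  rw [decim_sub hp, decim_derivative hp, sub_zero, hH, decim_expand_mul_X_pow hp, hc,
    Finset.mul_sum, decim_sum hp] at this
  rw [this]
  refine Finset.sum_congr rfl fun j _ => ?_
  rw [hΦ, prod_X_sub_C_pow_divByMonic z (fun i => (hm i).1), mul_left_comm, decim_C_mul hp]

end Surjectivity

/-! ### Decimation of master polynomials -/

section MasterPoly

variable {R : Type*} [CommRing R] {p : ℕ} [Fact p.Prime] [CharP R p] {ι : Type*} [Fintype ι]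

theorem expand_X_sub_C_pow (a : R) : expand R p (X - C (a ^ p)) = (X - C a) ^ p := by
  rw [map_sub, expand_X, expand_C, sub_pow_char, C_pow]

/-- Enlarging the exponents by multiples of `p` multiplies the decimation by a monic polynomial with
coefficients in `𝔽_p[z ^ p]`. -/
theorem decim_divByMonic_add (z : ι → R) {m : ι → ℕ} (e : ι → ℕ) (hm : ∀ i, 0 < m i) (j : ι) :
    decim p ((∏ i, (X - C (z i)) ^ (m i + p * e i)) /ₘ (X - C (z j))) =
      (∏ i, (X - C (z i ^ p)) ^ e i) *
        decim p ((∏ i, (X - C (z i)) ^ m i) /ₘ (X - C (z j))) := by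
  have hp : 0 < p := (Fact.out : p.Prime).pos
  have h1 : ∏ i, (X - C (z i)) ^ (m i + p * e i) =
      expand R p (∏ i, (X - C (z i ^ p)) ^ e i) * ∏ i, (X - C (z i)) ^ m i := by
    rw [map_prod, ← Finset.prod_mul_distrib]
    refine Finset.prod_congr rfl fun i _ => ?_
    rw [map_pow, expand_X_sub_C_pow, ← pow_mul, pow_add, mul_comm]
  obtain ⟨G, hG⟩ : X - C (z j) ∣ ∏ i, (X - C (z i)) ^ m i :=
    (dvd_pow_self _ (hm j).ne').trans
      (Finset.dvd_prod_of_mem (fun i => (X - C (z i)) ^ m i) (Finset.mem_univ j))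
  rw [h1, hG, mul_left_comm, mul_divByMonic_cancel_left _ (monic_X_sub_C _),
    mul_divByMonic_cancel_left _ (monic_X_sub_C _), decim_expand_mul hp]

theorem natDegree_divByMonic_prod_lt [Nontrivial R] (z : ι → R) {m : ι → ℕ} (hm : ∀ i, 0 < m i)
    (j : ι) : ((∏ i, (X - C (z i)) ^ m i) /ₘ (X - C (z j))).natDegree < ∑ i, m i := by
  have h1 : (∏ i, (X - C (z i)) ^ m i).natDegree = ∑ i, m i := by
    rw [natDegree_prod_of_monic _ _ fun _ _ => (monic_X_sub_C _).pow _]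
    exact Finset.sum_congr rfl fun i _ => by
      rw [(monic_X_sub_C _).natDegree_pow, natDegree_X_sub_C, mul_one]
  rw [natDegree_divByMonic _ (monic_X_sub_C _), natDegree_X_sub_C, h1]
  have := (hm j).trans_le (Finset.single_le_sum (fun i _ => Nat.zero_le (m i)) (Finset.mem_univ j))
  omega

theorem coeff_decim_divByMonic_eq_zero (z : ι → R) {m : ι → ℕ} (hm : ∀ i, 0 < m i)
    (j : ι) {l : ℕ} (hl : ∑ i, m i < l * p + p) :
    (decim p ((∏ i, (X - C (z i)) ^ m i) /ₘ (X - C (z j)))).coeff l = 0 := by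
  have : Nontrivial R := CharP.nontrivial_of_char_ne_one (Fact.out : p.Prime).ne_one
  rw [coeff_decim (Fact.out : p.Prime).pos]
  refine coeff_eq_zero_of_natDegree_lt ?_
  have := natDegree_divByMonic_prod_lt z hm j
  omega

end MasterPoly

/-! ### Spans of coefficient vectors -/

/-- Multiplication by a monic polynomial over `R` does not change the `R`-span of the coefficients
of a vector of polynomials. -/
theorem span_coeff_monic_mul {R S ι : Type*} [CommRing R] [CommRing S] [Algebra R S] [Finite ι]
    {E : R[X]} (hE : E.Monic) (f : ι → S[X]) :
    Submodule.span R (Set.range fun (l : ℕ) j => (E.map (algebraMap R S) * f j).coeff l) =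
      Submodule.span R (Set.range fun (l : ℕ) j => (f j).coeff l) := by
  have := Fintype.ofFinite ι
  have hcoeff : ∀ l, (fun j => (E.map (algebraMap R S) * f j).coeff l) =
      ∑ x ∈ Finset.HasAntidiagonal.antidiagonal l, E.coeff x.1 • fun j => (f j).coeff x.2 := by
    intro l
    ext j
    rw [coeff_mul, Finset.sum_apply]
    refine Finset.sum_congr rfl fun x _ => ?_
    rw [coeff_map, Pi.smul_apply, Algebra.smul_def]
  apply le_antisymm
  · rw [Submodule.span_le]
    rintro _ ⟨l, rfl⟩
    change (fun j => (E.map (algebraMap R S) * f j).coeff l) ∈ _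
    rw [hcoeff]
    exact Submodule.sum_mem _ fun x _ => Submodule.smul_mem _ _ (Submodule.subset_span ⟨x.2, rfl⟩)
  · rw [Submodule.span_le]
    obtain ⟨N, hN⟩ : ∃ N, ∀ j, (f j).natDegree < N :=
      ⟨∑ j, (f j).natDegree + 1, fun j => Nat.lt_succ_of_le
        (Finset.single_le_sum (fun i _ => Nat.zero_le (f i).natDegree) (Finset.mem_univ j))⟩
    -- Descending induction on `l`, starting beyond all degrees: as `E` is monic, coefficient `deg E
    -- + l` of the product is coefficient `l` of `f` plus a combination of higher ones.
    have key : ∀ r l, N ≤ l + r → (fun j => (f j).coeff l) ∈ Submodule.span R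
        (Set.range fun (l : ℕ) j => (E.map (algebraMap R S) * f j).coeff l) := by
      intro r
      induction r with
      | zero =>
        intro l hl
        have : (fun j => (f j).coeff l) = 0 := by
          ext j
          exact coeff_eq_zero_of_natDegree_lt ((hN j).trans_le hl)
        rw [this]
        exact Submodule.zero_mem _
      | succ r ih =>
        intro l hl
        have h1 := hcoeff (E.natDegree + l)
        have hmem : (E.natDegree, l) ∈ Finset.HasAntidiagonal.antidiagonal (E.natDegree + l) :=
          Finset.HasAntidiagonal.mem_antidiagonal.mpr rfl
        rw [← Finset.add_sum_erase _ _ hmem, coeff_natDegree, hE.leadingCoeff, one_smul] at h1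
        rw [← sub_eq_iff_eq_add] at h1
        rw [← h1]
        refine Submodule.sub_mem _ (Submodule.subset_span ⟨_, rfl⟩)
          (Submodule.sum_mem _ fun x hx => ?_)
        rw [Finset.mem_erase, Finset.HasAntidiagonal.mem_antidiagonal] at hx
        rcases lt_trichotomy x.1 E.natDegree with h | h | h
        · exact Submodule.smul_mem _ _ (ih _ (by omega))
        · exact absurd (Prod.ext h (by have := hx.2; simp only; omega)) hx.1
        · rw [coeff_eq_zero_of_natDegree_lt h, zero_smul]
          exact Submodule.zero_mem _
    rintro _ ⟨l, rfl⟩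
    exact key N l (by omega)

/-! ### Independence of the coefficient vectors -/

/-- Row rank equals column rank: a relation among the coefficient vectors is a functional vanishing
on all the decimated polynomials. Their span contains every `X ^ l` with `l < d`, so the functional
is zero. -/
theorem eq_zero_of_sum_coeff_decim_eq_zero {K : Type*} [Field K] {p : ℕ} [Fact p.Prime] [CharP K p]
    {ι : Type*} [Fintype ι] [DecidableEq ι] {z : ι → K} (hz : Function.Injective z) {m : ι → ℕ}
    (hm : ∀ i, 0 < m i ∧ m i ≤ p) {d : ℕ} (hd : d * p ≤ ∑ i, m i) (c : Fin d → K)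
    (hc : ∀ j, ∑ l : Fin d, c l *
      (decim p ((∏ i, (X - C (z i)) ^ m i) /ₘ (X - C (z j)))).coeff l = 0) : c = 0 := by
  ext l
  obtain ⟨b, hb⟩ := exists_sum_decim_eq (p := p) hz hm (X ^ (l : ℕ)) (by
    intro i hi
    rw [coeff_X_pow, if_neg]
    rintro rfl
    have : ((l : ℕ) + 1) * p ≤ d * p := Nat.mul_le_mul_right _ l.2
    rw [add_one_mul] at this
    omega)
  have h1 : ∑ s : Fin d, c s * (X ^ (l : ℕ) : K[X]).coeff s = c l := by
    rw [Finset.sum_eq_single l]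
    · simp
    · intro s _ hs
      rw [coeff_X_pow, if_neg (fun h => hs (Fin.ext h)), mul_zero]
    · simp
  rw [← h1, ← hb]
  simp only [finsetSum_coeff, coeff_C_mul, Finset.mul_sum]
  rw [Finset.sum_comm]
  refine Finset.sum_eq_zero fun j _ => ?_
  have h2 := congrArg (b j * ·) (hc j)
  simp only [mul_zero, Finset.mul_sum] at h2
  rw [← h2]
  exact Finset.sum_congr rfl fun s _ => by ring

/-! ### The module of arithmetic solutions does not depend on the admissible vector -/

section SolModule

variable {p n : ℕ}

theorem solVec_eq_coeff_decim [Fact p.Prime] (M : Fin n → ℕ) (l : ℕ) :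
    solVec p M (l * p + p - 1) = fun j => (decim p ((∏ i, (X - C (MvPolynomial.X i)) ^ M i) /ₘ
      (X - C (MvPolynomial.X j)) : (MvPolynomial (Fin n) (ZMod p))[X])).coeff l := by
  ext1 j
  rw [coeff_decim (Fact.out : p.Prime).pos]
  rfl

theorem solModule_eq_span (M : Fin n → ℕ) : solModule p M =
    Submodule.span (PolyZp p n) (Set.range fun l : ℕ => solVec p M (l * p + p - 1)) := by
  rw [solModule]
  congr 1
  ext v
  constructor
  · rintro ⟨l, hl, rfl⟩
    refine ⟨l - 1, ?_⟩
    obtain ⟨r, rfl⟩ : ∃ r, l = r + 1 := ⟨l - 1, by omega⟩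
    simp only [Nat.add_sub_cancel, add_one_mul]
  · rintro ⟨l, rfl⟩
    exact ⟨l + 1, Nat.succ_pos _, by simp only [add_one_mul]⟩

variable [Fact p.Prime]

theorem solModule_add (m e : Fin n → ℕ) (hm : ∀ i, 0 < m i) :
    solModule p (fun i => m i + p * e i) = solModule p m := by
  rw [solModule_eq_span, solModule_eq_span]
  simp only [solVec_eq_coeff_decim]
  let E : (PolyZp p n)[X] := ∏ i, (X - C ⟨MvPolynomial.X i ^ p,
    Algebra.subset_adjoin ⟨i, rfl⟩⟩) ^ e i
  have hE : E.Monic := monic_prod_of_monic _ _ fun _ _ => (monic_X_sub_C _).pow _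
  have hmap : E.map (algebraMap (PolyZp p n) (MvPolynomial (Fin n) (ZMod p))) =
      ∏ i, (X - C (MvPolynomial.X i ^ p)) ^ e i := by
    rw [Polynomial.map_prod]
    refine Finset.prod_congr rfl fun i _ => ?_
    rw [Polynomial.map_pow, Polynomial.map_sub, map_X, map_C]
    rfl
  have key := span_coeff_monic_mul hE fun j =>
    decim p ((∏ i, (X - C (MvPolynomial.X i)) ^ m i) /ₘ
      (X - C (MvPolynomial.X j)) : (MvPolynomial (Fin n) (ZMod p))[X])
  rw [hmap] at key
  simp only [decim_divByMonic_add _ e hm]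
  exact key

theorem solModule_eq_of_isAdmissible {q : ℕ} {Λ M M' : Fin n → ℕ} (h : IsAdmissible p q Λ M)
    (h' : IsAdmissible p q Λ M') : solModule p M = solModule p M' := by
  have hmod : ∀ i, M i ≡ M' i [MOD p] := fun i => by
    rw [← ZMod.natCast_eq_natCast_iff, (h i).2, (h' i).2]
  -- Both vectors arise from their componentwise minimum by adding multiples of `p`.
  let m : Fin n → ℕ := fun i => min (M i) (M' i)
  have hm : ∀ i, 0 < m i := fun i => lt_min (h i).1 (h' i).1
  have aux : ∀ {N : Fin n → ℕ}, (∀ i, m i ≤ N i) → (∀ i, m i ≡ N i [MOD p]) →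
      solModule p N = solModule p m := by
    intro N h1 h2
    rw [← solModule_add m (fun i => (N i - m i) / p) hm]
    congr 1
    ext i
    rw [Nat.mul_div_cancel' ((Nat.modEq_iff_dvd' (h1 i)).mp (h2 i)), Nat.add_sub_cancel' (h1 i)]
  rw [aux (fun i => min_le_left _ _) (fun i => ?_), aux (fun i => min_le_right _ _) (fun i => ?_)]
  · rcases min_choice (M i) (M' i) with h | h
    · simp only [m, h]; exact hmod i
    · simp only [m, h]; rfl
  · rcases min_choice (M i) (M' i) with h | h
    · simp only [m, h]; rfl
    · simp only [m, h]; exact (hmod i).symm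

end SolModule

/-! ### Reduction of the exponents modulo `p` -/

/-- The exponents `M̃_j - p ⌊Λ_j a / q⌋`. -/
def reducedM (p q : ℕ) {n : ℕ} (Λ : Fin n → ℕ) (a : ℕ) : Fin n → ℕ :=
  fun j => tildeM p q Λ a j - p * (Λ j * a / q)

section Reduced

variable {p q k n a : ℕ} {Λ : Fin n → ℕ}

/-- With `r = Λ_j a mod q`, the reduced exponent `m_j` satisfies `q m_j = p r - Λ_j`. Primality of
`q` gives `0 < r < q`, and together with `0 < Λ_j < q < p` this places `m_j` strictly between `0`
and `p`. -/
theorem tildeM_eq_reducedM_add (hq : q.Prime) (hqp : q < p)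
    (hΛ : ∀ j, 0 < Λ j ∧ Λ j < q) (ha : 1 ≤ a ∧ a < q) (hap : q ∣ a * p - 1) (j : Fin n) :
    (0 < reducedM p q Λ a j ∧ reducedM p q Λ a j < p) ∧
      tildeM p q Λ a j = reducedM p q Λ a j + p * (Λ j * a / q) := by
  obtain ⟨s, hs⟩ := hap
  have hap1 : 1 ≤ a * p := Nat.mul_pos ha.1 (by omega)
  have hs' : a * p = q * s + 1 := by omega
  have hM : tildeM p q Λ a j = Λ j * s := by
    rw [tildeM, hs, Nat.mul_div_cancel_left _ hq.pos]
  have hr := Nat.div_add_mod (Λ j * a) q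
  have hr1 := Nat.mod_lt (Λ j * a) hq.pos
  have hr0 : 0 < Λ j * a % q := by
    rw [Nat.pos_iff_ne_zero, Ne, ← Nat.dvd_iff_mod_eq_zero, hq.dvd_mul]
    rintro (h | h)
    · exact absurd (Nat.le_of_dvd (hΛ j).1 h) (not_le.mpr (hΛ j).2)
    · exact absurd (Nat.le_of_dvd ha.1 h) (not_le.mpr ha.2)
  rw [reducedM, hM]
  set r := Λ j * a % q
  set e := Λ j * a / q
  have hΛj := hΛ j
  have h1 : q * (Λ j * s) + Λ j = q * (p * e) + p * r := by
    calc q * (Λ j * s) + Λ j = Λ j * (q * s + 1) := by ring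
      _ = p * (Λ j * a) := by rw [← hs']; ring
      _ = _ := by rw [← hr]; ring
  have hpr : p ≤ p * r := Nat.le_mul_of_pos_right p hr0
  have h2 : p * e < Λ j * s := by
    by_contra! h
    have := Nat.mul_le_mul_left q h
    omega
  obtain ⟨x, hx⟩ := Nat.exists_eq_add_of_lt h2
  have h3 : Λ j * s - p * e = x + 1 := by omega
  refine ⟨⟨by omega, ?_⟩, by omega⟩
  rw [h3]
  by_contra! h
  have h4 : q * (p * e + p) ≤ q * (Λ j * s) := Nat.mul_le_mul_left q (by omega)
  rw [mul_add] at h4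
  have h5 : p * (r + 1) ≤ p * q := Nat.mul_le_mul_left p hr1
  rw [mul_add, mul_one, mul_comm p q] at h5
  omega

/-- If `a p = q s + 1`, then `∑ M̃_j = (k q + 1) s = a k p + (s - k)`, so the remainder is `r = s -
k`. The assumption `k q + 1 < p` gives `k ≤ s`, and `a < q` gives `s < p`. -/
theorem sum_reducedM (hq : q.Prime) (hqp : q < p) (hp : k * q + 1 < p)
    (hΛ : ∀ j, 0 < Λ j ∧ Λ j < q) (hsum : ∑ j, Λ j = k * q + 1) (ha : 1 ≤ a ∧ a < q)
    (hap : q ∣ a * p - 1) :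
    ∃ d r, a * k = (∑ j, Λ j * a / q) + d ∧ ∑ j, reducedM p q Λ a j = d * p + r ∧ r < p := by
  have h1 : ∑ j, tildeM p q Λ a j = ∑ j, reducedM p q Λ a j + p * ∑ j, Λ j * a / q := by
    rw [Finset.mul_sum, ← Finset.sum_add_distrib]
    exact Finset.sum_congr rfl fun j _ => (tildeM_eq_reducedM_add hq hqp hΛ ha hap j).2
  obtain ⟨s, hs⟩ := hap
  have hap1 : 1 ≤ a * p := Nat.mul_pos ha.1 (by omega)
  have hs' : a * p = q * s + 1 := by omega
  have h2 : ∑ j, tildeM p q Λ a j = (k * q + 1) * s := by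
    simp only [tildeM, hs, Nat.mul_div_cancel_left _ hq.pos]
    rw [← Finset.sum_mul, hsum]
  set e := ∑ j, Λ j * a / q
  set m := ∑ j, reducedM p q Λ a j
  have hks : k ≤ s := by
    have : p ≤ a * p := Nat.le_mul_of_pos_left p ha.1
    have : q * k ≤ q * s := by rw [mul_comm q k]; omega
    exact Nat.le_of_mul_le_mul_left this hq.pos
  have hsp : s < p := by
    have : q * s < q * p := by
      have := Nat.mul_le_mul_right p ha.2.le
      omega
    exact Nat.lt_of_mul_lt_mul_left this
  have h3 : (k * q + 1) * s + k = a * k * p + s := by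
    calc (k * q + 1) * s + k = k * (q * s + 1) + s := by ring
      _ = _ := by rw [← hs']; ring
  have he : e ≤ a * k := by
    by_contra! h
    have : p * (a * k + 1) ≤ p * e := Nat.mul_le_mul_left p h
    rw [mul_add, mul_one, mul_comm p (a * k)] at this
    omega
  obtain ⟨d, hd⟩ := Nat.exists_eq_add_of_le he
  refine ⟨d, s - k, hd, ?_, by omega⟩
  rw [hd, add_mul e d, mul_comm e p] at h3
  omega

theorem tildeM_isAdmissible [Fact p.Prime] (hq : q.Prime) (hqp : q < p)
    (hΛ : ∀ j, 0 < Λ j ∧ Λ j < q) (ha : 1 ≤ a ∧ a < q) (hap : q ∣ a * p - 1) :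
    IsAdmissible p q Λ (tildeM p q Λ a) := by
  intro j
  obtain ⟨⟨h1, -⟩, h2⟩ := tildeM_eq_reducedM_add hq hqp hΛ ha hap j
  refine ⟨by omega, ?_⟩
  obtain ⟨s, hs⟩ := hap
  have hap1 : 1 ≤ a * p := Nat.mul_pos ha.1 (by omega)
  have hs' : a * p = q * s + 1 := by omega
  have hq0 : (q : ZMod p) ≠ 0 := by
    rw [Ne, ZMod.natCast_eq_zero_iff]
    exact fun h => absurd (Nat.le_of_dvd hq.pos h) (not_le.mpr hqp)
  have h3 := congrArg (Nat.cast : ℕ → ZMod p) hs'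
  push_cast at h3
  rw [CharP.cast_eq_zero (ZMod p) p, mul_zero] at h3
  rw [tildeM, hs, Nat.mul_div_cancel_left _ hq.pos, ← neg_div, eq_div_iff hq0]
  push_cast
  linear_combination (-(Λ j : ZMod p)) * h3

theorem reducedM_isAdmissible [Fact p.Prime] (hq : q.Prime) (hqp : q < p)
    (hΛ : ∀ j, 0 < Λ j ∧ Λ j < q) (ha : 1 ≤ a ∧ a < q) (hap : q ∣ a * p - 1) :
    IsAdmissible p q Λ (reducedM p q Λ a) := by
  intro j
  obtain ⟨⟨h1, -⟩, h2⟩ := tildeM_eq_reducedM_add hq hqp hΛ ha hap j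
  refine ⟨h1, ?_⟩
  rw [← (tildeM_isAdmissible hq hqp hΛ ha hap j).2, h2]
  simp

/-- For natural `x`, the ceiling of `(x + 1) / q - 1` is the floor of `x / q`; from here on `e_j(a)`
appears as a natural-number quotient. -/
theorem eSum_eq (hq : q.Prime) : eSum q Λ a = ((∑ j, Λ j * a / q : ℕ) : ℤ) := by
  rw [eSum, Nat.cast_sum]
  refine Finset.sum_congr rfl fun j _ => ?_
  have hq0 : (0 : ℚ) < q := by exact_mod_cast hq.pos
  have h1 := Nat.div_add_mod (Λ j * a) q
  have h2 := Nat.mod_lt (Λ j * a) hq.pos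
  rw [Int.ceil_eq_iff]
  set e := Λ j * a / q
  set r := Λ j * a % q
  have h3 : (Λ j : ℚ) * a = q * e + r := by exact_mod_cast h1.symm
  have h4 : (r : ℚ) + 1 ≤ q := by exact_mod_cast h2
  rw [h3]
  push_cast
  constructor
  · rw [sub_lt_sub_iff_right, lt_div_iff₀ hq0]
    have : (0 : ℚ) ≤ r := by positivity
    linarith
  · rw [sub_le_iff_le_add, div_le_iff₀ hq0]
    linarith

end Reduced

/-! ### Valuations with pairwise distinct values -/

section Valuation

/-- Terms of distinct values cannot cancel, so the largest one determines the value of the sum. -/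
theorem valuation_le_sum_of_distinct {L Γ ι : Type*} [Field L] [LinearOrderedCommGroupWithZero Γ]
    [Fintype ι] (v : Valuation L Γ) (g : ι → L)
    (h : ∀ i j, i ≠ j → g i ≠ 0 → g j ≠ 0 → v (g i) ≠ v (g j)) (i : ι) :
    v (g i) ≤ v (∑ j, g j) := by
  classical
  obtain ⟨j, -, hj⟩ := Finset.exists_max_image Finset.univ (fun i => v (g i)) ⟨i, Finset.mem_univ i⟩
  by_cases h0 : g j = 0
  · have := hj i (Finset.mem_univ i)
    simp only [h0, map_zero] at this
    exact this.trans zero_le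
  rw [v.map_sum_eq_of_lt (Finset.mem_univ j)]
  · exact hj i (Finset.mem_univ i)
  · intro l hl
    have hlj : l ≠ j := by simpa using hl
    by_cases hl0 : g l = 0
    · rw [hl0, map_zero]
      exact zero_lt_iff.mpr (v.ne_zero_iff.mpr h0)
    · exact lt_of_le_of_ne (hj l (Finset.mem_univ l)) (h l j hlj hl0 h0)

/-- If the valuation group of a subfield `F` is generated by `v w` and `[L : F] < p`, then `v w` is
not a `p`-th power in the value group of `L`. -/
theorem valuation_ne_pow {F L Γ : Type*} [Field F] [Field L] [Algebra F L] [FiniteDimensional F L]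
    [LinearOrderedCommGroupWithZero Γ] (v : Valuation L Γ) {p : ℕ}
    (hp : Module.finrank F L < p) {w : L} (h0 : w ≠ 0) (h1 : v w < 1)
    (hw : ∀ f : F, f ≠ 0 → ∃ k : ℤ, v (algebraMap F L f) = v w ^ k) (b : L) : v w ≠ v b ^ p := by
  intro hb
  have hvb : v b ≠ 0 := by
    intro h
    rw [h, zero_pow (by omega)] at hb
    exact h0 (v.zero_iff.mp hb)
  have hvb1 : v b < 1 := by
    by_contra! h
    exact absurd (hb ▸ one_le_pow_of_one_le' h p) (not_le.mpr h1)
  have hinj : Function.Injective fun k : ℤ => v b ^ k :=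
    (zpow_right_strictAnti₀ (zero_lt_iff.mpr hvb) hvb1).injective
  -- If `v w = v b ^ p`, a term `c_i b ^ i` with `c_i ≠ 0` in `F` has value `v b ^ (p k + i)`. These
  -- differ for distinct `i < p`, so the `p` powers of `b` are independent over `F`, against `[L :
  -- F] < p`.
  have hli : LinearIndependent F fun i : Fin p => b ^ (i : ℕ) := by
    rw [Fintype.linearIndependent_iff]
    intro c hc i
    by_contra hci
    have hval : ∀ i, c i ≠ 0 → ∃ k : ℤ, v (c i • b ^ (i : ℕ)) = v b ^ ((p : ℤ) * k + (i : ℕ)) := by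
      intro i hi
      obtain ⟨k, hk⟩ := hw (c i) hi
      refine ⟨k, ?_⟩
      rw [Algebra.smul_def, map_mul, hk, hb, map_pow, zpow_add₀ hvb, zpow_mul, zpow_natCast,
        zpow_natCast]
    have hle := valuation_le_sum_of_distinct v (fun i => c i • b ^ (i : ℕ)) (by
      intro i j hij hi hj h
      obtain ⟨k, hk⟩ := hval i (by rintro h; simp [h] at hi)
      obtain ⟨l, hl⟩ := hval j (by rintro h; simp [h] at hj)
      rw [hk, hl] at h
      have h2 := hinj h
      apply hij
      have h3 : ((i : ℕ) : ℤ) % p = ((j : ℕ) : ℤ) % p := by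
        have := congrArg (· % (p : ℤ)) h2
        simpa [Int.add_emod] using this
      rw [Int.emod_eq_of_lt (by positivity) (by exact_mod_cast i.2),
        Int.emod_eq_of_lt (by positivity) (by exact_mod_cast j.2)] at h3
      exact Fin.ext (by exact_mod_cast h3)) i
    rw [hc, map_zero] at hle
    obtain ⟨k, hk⟩ := hval i hci
    simp only [hk] at hle
    exact zpow_ne_zero _ hvb (le_antisymm hle zero_le)
  have := hli.fintype_card_le_finrank
  rw [Fintype.card_fin] at this
  omega

/-- By Bézout for `p` and `n`, if `v w ^ n` were a `p`-th power then so would be `v w`. -/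
theorem valuation_pow_ne_pow {L Γ : Type*} [Field L] [LinearOrderedCommGroupWithZero Γ]
    (v : Valuation L Γ) {p : ℕ} (hp : p.Prime) {w : L} (h0 : w ≠ 0)
    (hw : ∀ b, v w ≠ v b ^ p) {n : ℤ} (hn : ¬ (p : ℤ) ∣ n) (a : L) :
    v w ^ n ≠ v a ^ p := by
  intro h
  have hvw : v w ≠ 0 := v.ne_zero_iff.mpr h0
  obtain ⟨s, t, hst⟩ := ((Nat.prime_iff_prime_int.mp hp).coprime_iff_not_dvd.mpr hn)
  refine hw (w ^ s * a ^ t) ?_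
  rw [map_mul, map_zpow₀, map_zpow₀, mul_pow]
  have e1 : (v a ^ t) ^ p = (v w ^ n) ^ t := by
    rw [h, ← zpow_natCast, ← zpow_natCast, ← zpow_mul, ← zpow_mul, mul_comm]
  rw [e1, ← zpow_natCast, ← zpow_mul, ← zpow_mul, ← zpow_add₀ hvw, mul_comm n, hst, zpow_one]

end Valuation

/-! ### Euler derivations preserve valuation rings -/

section Euler

variable {L : Type*} [Field L] (p : ℕ) [Fact p.Prime] [CharP L p]

/-- The subfield of `p`-th powers. -/
noncomputable abbrev powSubfield : Subfield L := (frobenius L p).fieldRange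

/-- The powers `w ^ i`, `i < p`, have values in different classes modulo `p`-th powers, hence form a
basis of `L` over `L ^ p`. Since `δ` kills `L ^ p`, it multiplies the component of `f` at `w ^ i` by
`i`. Each component has value at most that of `f`; the component `i = 0` is killed, and the others
cannot have value `1`. No discreteness of the valuation or ramification index is needed. -/
theorem valuation_euler_lt_one [FiniteDimensional (powSubfield (L := L) p) L]
    (hfin : Module.finrank (powSubfield (L := L) p) L ≤ p) (O : ValuationSubring L) {w : L}
    (h0 : w ≠ 0) (hw : ∀ b, O.valuation w ≠ O.valuation b ^ p) (δ : Derivation ℤ L L)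
    (hδ : δ w = w) {f : L} (hf : f ∈ O) : O.valuation (δ f) < 1 := by
  have hp := (Fact.out : p.Prime)
  have hvw : O.valuation w ≠ 0 := O.valuation.ne_zero_iff.mpr h0
  have hdist : ∀ c : Fin p → powSubfield (L := L) p, ∀ i j, i ≠ j →
      c i • w ^ (i : ℕ) ≠ 0 → c j • w ^ (j : ℕ) ≠ 0 →
      O.valuation (c i • w ^ (i : ℕ)) ≠ O.valuation (c j • w ^ (j : ℕ)) := by
    intro c i j hij hi hj h
    obtain ⟨a, ha⟩ := (c i).2
    obtain ⟨b, hb⟩ := (c j).2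
    rw [Subfield.smul_def, ← ha, smul_eq_mul, frobenius_def] at hi h
    rw [Subfield.smul_def, ← hb, smul_eq_mul, frobenius_def] at hj h
    have ha0 : O.valuation a ≠ 0 := O.valuation.ne_zero_iff.mpr (by
      rintro rfl; simp [hp.ne_zero] at hi)
    -- Equal values would make `v w ^ (i - j)` a `p`-th power, although `0 < |i - j| < p`.
    refine valuation_pow_ne_pow O.valuation hp h0 hw (n := (i : ℕ) - (j : ℕ)) ?_ (b / a) ?_
    · intro hd
      have h1 := i.2
      have h2 := j.2
      have := Int.eq_zero_of_abs_lt_dvd hd (by rw [abs_lt]; constructor <;> omega)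
      exact hij (Fin.ext (by omega))
    · simp only [map_mul, map_pow] at h
      rw [zpow_sub₀ hvw, zpow_natCast, zpow_natCast, map_div₀, div_pow,
        div_eq_div_iff (pow_ne_zero _ hvw) (pow_ne_zero _ ha0), mul_comm, h, mul_comm]
  have hli : LinearIndependent (powSubfield (L := L) p) fun i : Fin p => w ^ (i : ℕ) := by
    rw [Fintype.linearIndependent_iff]
    intro c hc i
    have := valuation_le_sum_of_distinct O.valuation _ (hdist c) i
    rw [hc, map_zero] at this
    have := O.valuation.zero_iff.mp (le_antisymm this zero_le)
    exact (smul_eq_zero.mp this).resolve_right (pow_ne_zero _ h0)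
  have hcard : Fintype.card (Fin p) = Module.finrank (powSubfield (L := L) p) L :=
    le_antisymm hli.fintype_card_le_finrank (by simpa using hfin)
  have hspan := hli.span_eq_top_of_card_eq_finrank' hcard
  obtain ⟨c, hc⟩ := (Submodule.mem_span_range_iff_exists_fun _).mp (hspan ▸ Submodule.mem_top (x := f))
  have hle := valuation_le_sum_of_distinct O.valuation _ (hdist c)
  rw [hc] at hle
  have hδc : ∀ i, δ (c i • w ^ (i : ℕ)) = ((i : ℕ) : L) * (c i • w ^ (i : ℕ)) := by
    intro i
    obtain ⟨a, ha⟩ := (c i).2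
    rw [Subfield.smul_def, ← ha, smul_eq_mul, frobenius_def, Derivation.leibniz,
      Derivation.leibniz_pow, Derivation.leibniz_pow, hδ]
    simp only [nsmul_eq_mul, CharP.cast_eq_zero, zero_mul, smul_eq_mul]
    rcases Nat.eq_zero_or_pos (i : ℕ) with h | h
    · simp [h]
    · rw [mul_zero, add_zero, ← pow_succ, Nat.sub_add_cancel h]
      ring
  rw [← hc, map_sum]
  refine O.valuation.map_sum_lt one_ne_zero fun i _ => ?_
  rw [hδc]
  rcases Nat.eq_zero_or_pos (i : ℕ) with h | h
  · simp [h]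
  rw [map_mul]
  have hi1 : O.valuation (c i • w ^ (i : ℕ)) < 1 := by
    refine lt_of_le_of_ne ((hle i).trans ((O.valuation_le_one_iff f).mpr hf)) fun h1 => ?_
    obtain ⟨a, ha⟩ := (c i).2
    rw [Subfield.smul_def, ← ha, smul_eq_mul, frobenius_def, map_mul, map_pow, map_pow] at h1
    refine valuation_pow_ne_pow O.valuation hp h0 hw (n := (i : ℕ)) ?_ a⁻¹ ?_
    · rw [Int.natCast_dvd_natCast]
      exact fun hd => absurd (Nat.le_of_dvd h hd) (by have := i.2; omega)
    · rw [zpow_natCast, map_inv₀, inv_pow]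
      exact eq_inv_of_mul_eq_one_right h1
  have hi2 : O.valuation ((i : ℕ) : L) ≤ 1 := (O.valuation_le_one_iff _).mpr (natCast_mem O _)
  calc _ ≤ 1 * O.valuation (c i • w ^ (i : ℕ)) := by gcongr
    _ < 1 := by rwa [one_mul]

/-- If `ω = h dx` is regular at `O`, then `h δ(x)` is in the maximal ideal, for every derivation
`δ` with `δ w = w`. -/
theorem valuation_mul_derivation_lt_one {K : Type*} [Field K] [Algebra K L]
    [FiniteDimensional (powSubfield (L := L) p) L]
    (hfin : Module.finrank (powSubfield (L := L) p) L ≤ p) (O : ValuationSubring L) {w : L}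
    (h0 : w ≠ 0) (hw : ∀ b, O.valuation w ≠ O.valuation b ^ p) (δ : Derivation K L L)
    (hδ : δ w = w) {h x : L} (hreg : IsRegularAt K L O (h • KaehlerDifferential.D K L x)) :
    O.valuation (h * δ x) < 1 := by
  have key : ∀ ω ∈ Submodule.span O (KaehlerDifferential.D K L '' (O : Set L)),
      O.valuation (δ.liftKaehlerDifferential ω) < 1 := by
    intro ω hω
    induction hω using Submodule.span_induction with
    | mem ω hω =>
      obtain ⟨f, hf, rfl⟩ := hω
      rw [Derivation.liftKaehlerDifferential_comp_D]
      exact valuation_euler_lt_one p hfin O h0 hw (δ.restrictScalars ℤ) hδ hf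
    | zero => simp
    | add a b _ _ ha hb =>
      rw [map_add]
      exact (O.valuation.map_add _ _).trans_lt (max_lt ha hb)
    | smul c a _ ha =>
      have : c • a = (c : L) • a := rfl
      rw [this, map_smul, smul_eq_mul, map_mul]
      calc _ ≤ 1 * O.valuation (δ.liftKaehlerDifferential a) := by
            gcongr
            exact O.valuation_le_one c
        _ < 1 := by rwa [one_mul]
  have := key _ hreg
  rwa [map_smul, Derivation.liftKaehlerDifferential_comp_D, smul_eq_mul] at this

end Euler

/-! ### Function fields: the derivation `d/dx` and the degree over the `p`-th powers -/

section FunctionField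

variable {K L : Type*} [Field K] [Field L] [Algebra K L] [Algebra (RatFunc K) L]
  [IsScalarTower K (RatFunc K) L]

theorem algebraMap_ratFunc_eq_aeval (P : K[X]) :
    algebraMap (RatFunc K) L (algebraMap K[X] (RatFunc K) P) =
      aeval (algebraMap (RatFunc K) L RatFunc.X) P := by
  rw [← RatFunc.aeval_X_left_eq_algebraMap, aeval_algebraMap_apply]

variable (K L) in
theorem aeval_ratFunc_X_injective :
    Function.Injective (aeval (R := K) (algebraMap (RatFunc K) L RatFunc.X)) := by
  intro P Q h
  rw [← algebraMap_ratFunc_eq_aeval, ← algebraMap_ratFunc_eq_aeval] at h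
  exact RatFunc.algebraMap_injective K ((algebraMap (RatFunc K) L).injective h)

-- This is the extension of `d/dx`. As `L` is separable over `K(x)`, it is formally étale over
-- `K[x]`, so its differentials are the base change of the free module generated by `dx`.
variable (K L) in
theorem exists_derivation_eq_one [Algebra.IsSeparable (RatFunc K) L] :
    ∃ D : Derivation K L L, D (algebraMap (RatFunc K) L RatFunc.X) = 1 := by
  let : Algebra K[X] L :=
    ((algebraMap (RatFunc K) L).comp (algebraMap K[X] (RatFunc K))).toAlgebra
  have : IsScalarTower K[X] (RatFunc K) L := IsScalarTower.of_algebraMap_eq fun _ => rfl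
  have : IsScalarTower K K[X] L := IsScalarTower.of_algebraMap_eq fun c => by
    rw [IsScalarTower.algebraMap_apply K (RatFunc K) L,
      IsScalarTower.algebraMap_apply K K[X] (RatFunc K)]
    rfl
  have : Algebra.FormallyEtale K[X] (RatFunc K) :=
    Algebra.FormallyEtale.of_isLocalization (nonZeroDivisors K[X])
  have : Algebra.FormallyEtale (RatFunc K) L := Algebra.FormallyEtale.of_isSeparable _ _
  have : Algebra.FormallyEtale K[X] L := Algebra.FormallyEtale.comp K[X] (RatFunc K) L
  let e : Ω[L⁄K] →ₗ[L] L :=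
    (TensorProduct.AlgebraTensorModule.rid K[X] L L).toLinearMap ∘ₗ
      (TensorProduct.AlgebraTensorModule.congr (LinearEquiv.refl L L)
        (KaehlerDifferential.polynomialEquiv K)).toLinearMap ∘ₗ
      (KaehlerDifferential.tensorKaehlerEquivOfFormallyEtale K K[X] L).symm.toLinearMap
  refine ⟨e.compDer (KaehlerDifferential.D K L), ?_⟩
  have hX : algebraMap (RatFunc K) L RatFunc.X = algebraMap K[X] L X := by
    rw [← RatFunc.algebraMap_X]; rfl
  change e (KaehlerDifferential.D K L _) = 1
  rw [hX]
  simp only [e, LinearMap.comp_apply, LinearEquiv.coe_coe,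
    KaehlerDifferential.tensorKaehlerEquivOfFormallyEtale_symm_D_algebraMap]
  simp

variable (K L) in
theorem D_ratFunc_X_ne_zero [Algebra.IsSeparable (RatFunc K) L] :
    KaehlerDifferential.D K L (algebraMap (RatFunc K) L RatFunc.X) ≠ 0 := by
  obtain ⟨D, hD⟩ := exists_derivation_eq_one K L
  intro h
  have := D.liftKaehlerDifferential_comp_D (algebraMap (RatFunc K) L RatFunc.X)
  rw [h, map_zero, hD] at this
  exact zero_ne_one this

theorem diffForm_injective [Algebra.IsSeparable (RatFunc K) L] {y : L} (hy : y ≠ 0) (a : ℕ) :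
    Function.Injective (diffForm K L y a) := by
  rw [injective_iff_map_eq_zero]
  intro u hu
  have h : (algebraMap (RatFunc K) L u * (y ^ a)⁻¹) •
    KaehlerDifferential.D K L (algebraMap (RatFunc K) L RatFunc.X) = 0 := hu
  have := (smul_eq_zero.mp h).resolve_right (D_ratFunc_X_ne_zero K L)
  have := (mul_eq_zero.mp this).resolve_right (inv_ne_zero (pow_ne_zero _ hy))
  exact (map_eq_zero _).mp this

variable {p q : ℕ} [Fact p.Prime] [CharP L p] [PerfectRing K p]

/-- `L` is generated over `L ^ p` by `x`, a root of `X ^ p - x ^ p`: perfectness puts `K` into `L ^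
p`, and Bézout writes `y` through `y ^ p` and `y ^ q`, the latter a rational function of `x`. -/
theorem finrank_powSubfield_le {y : L} {F : RatFunc K} (hpq : p.Coprime q)
    (hgen : IntermediateField.adjoin (RatFunc K) {y} = ⊤) (hy0 : y ≠ 0)
    (hy : y ^ q = algebraMap (RatFunc K) L F) :
    FiniteDimensional (powSubfield (L := L) p) L ∧
      Module.finrank (powSubfield (L := L) p) L ≤ p := by
  have hp := (Fact.out : p.Prime)
  set x : L := algebraMap (RatFunc K) L RatFunc.X
  set S := IntermediateField.adjoin (powSubfield (L := L) p) {x}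
  have hpow : ∀ a : L, a ^ p ∈ S := fun a => S.algebraMap_mem ⟨a ^ p, a, rfl⟩
  have hK : ∀ c : K, algebraMap K L c ∈ S := fun c => by
    obtain ⟨d, rfl⟩ := (PerfectRing.bijective_frobenius (R := K) (p := p)).2 c
    change algebraMap K L (d ^ p) ∈ S
    rw [map_pow]
    exact hpow _
  have hP : ∀ P : K[X], aeval x P ∈ S := fun P => by
    rw [aeval_eq_sum_range]
    refine sum_mem fun i _ => ?_
    rw [Algebra.smul_def]
    exact mul_mem (hK _) (pow_mem (IntermediateField.mem_adjoin_simple_self _ x) _)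
  have hR : ∀ u : RatFunc K, algebraMap (RatFunc K) L u ∈ S := fun u => by
    rw [← RatFunc.num_div_denom u, map_div₀, algebraMap_ratFunc_eq_aeval,
      algebraMap_ratFunc_eq_aeval]
    exact div_mem (hP _) (hP _)
  have hyS : y ∈ S := by
    obtain ⟨s, t, hst⟩ := (Nat.isCoprime_iff_coprime.mpr hpq : IsCoprime (p : ℤ) (q : ℤ))
    have : y = (y ^ p) ^ s * (y ^ q) ^ t := by
      rw [← zpow_natCast, ← zpow_natCast, ← zpow_mul, ← zpow_mul, ← zpow_add₀ hy0,
        mul_comm (p : ℤ), mul_comm (q : ℤ), hst, zpow_one]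
    rw [this, hy]
    exact mul_mem (zpow_mem (hpow y) _) (zpow_mem (hR F) _)
  have hStop : S = ⊤ := by
    refine top_unique fun f _ => ?_
    have hf : f ∈ IntermediateField.adjoin (RatFunc K) {y} := hgen ▸ IntermediateField.mem_top
    induction hf using IntermediateField.adjoin_induction with
    | mem f hf => rwa [Set.mem_singleton_iff.mp hf]
    | algebraMap u => exact hR u
    | add _ _ _ _ h1 h2 => exact add_mem (h1 trivial) (h2 trivial)
    | inv _ _ h1 => exact inv_mem (h1 trivial)
    | mul _ _ _ _ h1 h2 => exact mul_mem (h1 trivial) (h2 trivial)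
  have hmon : (X ^ p - C (⟨x ^ p, x, rfl⟩ : powSubfield (L := L) p)).Monic :=
    monic_X_pow_sub_C _ hp.ne_zero
  have hroot : aeval x (X ^ p - C (⟨x ^ p, x, rfl⟩ : powSubfield (L := L) p)) = 0 := by
    rw [map_sub, map_pow, aeval_X, aeval_C]
    exact sub_self _
  have hint : IsIntegral (powSubfield (L := L) p) x := ⟨_, hmon, hroot⟩
  have e : S ≃ₗ[powSubfield (L := L) p] L :=
    ((IntermediateField.equivOfEq hStop).trans IntermediateField.topEquiv).toLinearEquiv
  have : FiniteDimensional (powSubfield (L := L) p) S :=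
    IntermediateField.adjoin.finiteDimensional hint
  refine ⟨e.finiteDimensional, ?_⟩
  rw [← e.finrank_eq, IntermediateField.adjoin.finrank hint]
  have := natDegree_le_natDegree (minpoly.min _ x hmon hroot)
  rwa [natDegree_X_pow_sub_C] at this

end FunctionField

/-! ### Places -/

section Places

variable {L : Type*} [Field L]

/-- Supplies the places at which regularity is tested: above an irreducible polynomial in `x`, and
above infinity by taking `1 / x` as the variable. -/
theorem exists_valuationSubring_of_not_isUnit {B : Type*} [CommRing B] (f : B →+* L)
    (hf : Function.Injective f) {b : B} (hb : ¬ IsUnit b) :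
    ∃ O : ValuationSubring L, (∀ c, f c ∈ O) ∧ O.valuation (f b) < 1 := by
  obtain ⟨O, hO, hI⟩ := Ideal.image_subset_nonunits_valuationSubring
    (Ideal.span {f.rangeRestrict b}) (by
      rw [Ne, Ideal.span_singleton_eq_top]
      intro h
      obtain ⟨⟨_, c, rfl⟩, hc⟩ := isUnit_iff_exists_inv.mp h
      refine hb (isUnit_iff_exists_inv.mpr ⟨c, hf ?_⟩)
      rw [map_mul, map_one]
      exact congrArg Subtype.val hc)
  refine ⟨O, fun c => hO ⟨c, rfl⟩, O.mem_nonunits_iff.mp (hI ⟨f.rangeRestrict b, ?_, rfl⟩)⟩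
  exact Ideal.mem_span_singleton_self _

variable {K : Type*} [Field K] {O : ValuationSubring L} {f : K[X] →+* L} {π : K[X]}

theorem valuation_eq_one_of_not_dvd (hO : ∀ c, f c ∈ O) (hπ : Irreducible π)
    (hv : O.valuation (f π) < 1) {g : K[X]} (hg : ¬ π ∣ g) : O.valuation (f g) = 1 := by
  have h1 : O.valuation (f g) ≤ 1 := (O.valuation_le_one_iff _).mpr (hO g)
  refine h1.antisymm (not_lt.mp fun h => ?_)
  obtain ⟨s, t, hst⟩ := hπ.coprime_iff_not_dvd.mpr hg
  have h2 : ∀ s g, O.valuation (f g) < 1 → O.valuation (f (s * g)) < 1 := fun s g hg => by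
    rw [map_mul, map_mul]
    calc _ ≤ 1 * O.valuation (f g) := by
          gcongr
          exact (O.valuation_le_one_iff _).mpr (hO s)
      _ < 1 := by rwa [one_mul]
  have h3 : O.valuation (f (s * π + t * g)) < 1 := by
    rw [map_add]
    exact (O.valuation.map_add _ _).trans_lt (max_lt (h2 _ _ hv) (h2 _ _ h))
  rw [hst, map_one, map_one] at h3
  exact lt_irrefl _ h3

theorem exists_valuation_eq_pow (hO : ∀ c, f c ∈ O) (hπ : Irreducible π)
    (hv : O.valuation (f π) < 1) {g : K[X]} (hg : g ≠ 0) :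
    ∃ k : ℕ, O.valuation (f g) = O.valuation (f π) ^ k ∧ (π ∣ g → 1 ≤ k) := by
  obtain ⟨c, hc, hc'⟩ := (FiniteMultiplicity.of_not_isUnit hπ.not_isUnit hg :
    FiniteMultiplicity π g).exists_eq_pow_mul_and_not_dvd
  refine ⟨multiplicity π g, ?_, fun h => ?_⟩
  · conv_lhs => rw [hc]
    rw [map_mul, map_mul, map_pow, map_pow, valuation_eq_one_of_not_dvd hO hπ hv hc', mul_one]
  · by_contra h0
    have : multiplicity π g = 0 := by omega
    rw [this, pow_zero, one_mul] at hc
    exact hc' (hc ▸ h)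

theorem exists_valuation_algebraMap_eq_zpow [Algebra (RatFunc K) L] {w : L}
    (hw : O.valuation w ≠ 0)
    (h : ∀ g : K[X], g ≠ 0 →
      ∃ k : ℤ, O.valuation (algebraMap (RatFunc K) L (algebraMap K[X] _ g)) = O.valuation w ^ k)
    (u : RatFunc K) (hu : u ≠ 0) :
    ∃ k : ℤ, O.valuation (algebraMap (RatFunc K) L u) = O.valuation w ^ k := by
  obtain ⟨k, hk⟩ := h u.num (RatFunc.num_ne_zero hu)
  obtain ⟨l, hl⟩ := h u.denom u.denom_ne_zero
  refine ⟨k - l, ?_⟩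
  conv_lhs => rw [← RatFunc.num_div_denom u]
  rw [map_div₀, map_div₀, hk, hl, zpow_sub₀ hw]

end Places

/-! ### Regular differentials on superelliptic curves -/

/-- `L` is the function field of the curve `y ^ q = ∏ (x - z_j) ^ Λ_j` over the perfect field `K`
of characteristic `p > q`, with `0 < Λ_j < q` and `∑ Λ_j = k q + 1`. -/
structure IsSuperelliptic {K L : Type*} [Field K] [Field L] [Algebra K L] [Algebra (RatFunc K) L]
    {ι : Type*} [Fintype ι] (p q k : ℕ) (z : ι → K) (Λ : ι → ℕ) (y : L) : Prop where
  prime : q.Prime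
  lt : q < p
  pos : 0 < k
  injective : Function.Injective z
  bounds : ∀ j, 0 < Λ j ∧ Λ j < q
  sum_eq : ∑ j, Λ j = k * q + 1
  adjoin_eq_top : IntermediateField.adjoin (RatFunc K) {y} = ⊤
  pow_eq : y ^ q = algebraMap (RatFunc K) L
    (algebraMap K[X] (RatFunc K) (∏ j, (X - C (z j)) ^ Λ j))

namespace IsSuperelliptic

variable {K L : Type*} [Field K] [Field L] [Algebra K L] [Algebra (RatFunc K) L]
  {ι : Type*} [Fintype ι] {p q k : ℕ} {z : ι → K} {Λ : ι → ℕ}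
  {y : L}

theorem prod_monic (z : ι → K) (Λ : ι → ℕ) : (∏ j, (X - C (z j)) ^ Λ j).Monic :=
  monic_prod_of_monic _ _ fun _ _ => (monic_X_sub_C _).pow _

theorem natDegree_prod (z : ι → K) (Λ : ι → ℕ) :
    (∏ j, (X - C (z j)) ^ Λ j).natDegree = ∑ j, Λ j := by
  rw [natDegree_prod_of_monic _ _ fun _ _ => (monic_X_sub_C _).pow _]
  simp

theorem algebraMap_prod_ne_zero (z : ι → K) (Λ : ι → ℕ) :
    algebraMap K[X] (RatFunc K) (∏ j, (X - C (z j)) ^ Λ j) ≠ 0 :=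
  (map_ne_zero_iff _ (RatFunc.algebraMap_injective K)).mpr (prod_monic z Λ).ne_zero

theorem y_ne_zero (h : IsSuperelliptic p q k z Λ y) : y ≠ 0 := by
  rintro rfl
  have := h.pow_eq
  rw [zero_pow h.prime.ne_zero] at this
  exact algebraMap_prod_ne_zero z Λ ((map_eq_zero _).mp this.symm)

theorem aeval_root (h : IsSuperelliptic p q k z Λ y) : aeval y
    (X ^ q - C (algebraMap K[X] (RatFunc K) (∏ j, (X - C (z j)) ^ Λ j))) = 0 := by
  rw [map_sub, map_pow, aeval_X, aeval_C, h.pow_eq, sub_self]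

theorem isIntegral_y (h : IsSuperelliptic p q k z Λ y) : IsIntegral (RatFunc K) y :=
  ⟨_, monic_X_pow_sub_C _ h.prime.ne_zero, h.aeval_root⟩

/-- The function field is generated by `y`. -/
noncomputable def equivTop (h : IsSuperelliptic p q k z Λ y) :
    IntermediateField.adjoin (RatFunc K) {y} ≃ₐ[RatFunc K] L :=
  (IntermediateField.equivOfEq h.adjoin_eq_top).trans IntermediateField.topEquiv

theorem finiteDimensional (h : IsSuperelliptic p q k z Λ y) : FiniteDimensional (RatFunc K) L :=
  have := IntermediateField.adjoin.finiteDimensional h.isIntegral_y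
  h.equivTop.toLinearEquiv.finiteDimensional

theorem finrank_le (h : IsSuperelliptic p q k z Λ y) : Module.finrank (RatFunc K) L ≤ q := by
  rw [← h.equivTop.toLinearEquiv.finrank_eq, IntermediateField.adjoin.finrank h.isIntegral_y]
  have := natDegree_le_natDegree
    (minpoly.min _ y (monic_X_pow_sub_C _ h.prime.ne_zero) h.aeval_root)
  rwa [natDegree_X_pow_sub_C] at this

theorem isSeparable [CharP K p] (h : IsSuperelliptic p q k z Λ y) :
    Algebra.IsSeparable (RatFunc K) L := by
  have : CharP (RatFunc K) p := charP_of_injective_algebraMap (algebraMap K (RatFunc K)).injective p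
  have hq : ((q : ℕ) : RatFunc K) ≠ 0 := by
    rw [Ne, CharP.cast_eq_zero_iff (RatFunc K) p]
    exact fun hd => absurd (Nat.le_of_dvd h.prime.pos hd) (not_le.mpr h.lt)
  have hy : IsSeparable (RatFunc K) y :=
    (separable_X_pow_sub_C _ hq (algebraMap_prod_ne_zero z Λ)).of_dvd
      (minpoly.dvd _ _ h.aeval_root)
  have := (IntermediateField.isSeparable_adjoin_simple_iff_isSeparable _ _).mpr hy
  exact Algebra.IsSeparable.of_equiv_equiv (RingEquiv.refl (RatFunc K)) h.equivTop.toRingEquiv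
    (by ext; simp)

theorem coprime (h : IsSuperelliptic p q k z Λ y) (j : ι) : (Λ j).Coprime q :=
  (Nat.coprime_of_lt_prime (h.bounds j).1.ne' (h.bounds j).2 h.prime).symm

variable [IsScalarTower K (RatFunc K) L]

/-! #### Regular differentials of type `a` come from polynomials of bounded degree -/

/-- A regular differential `u dx / y ^ a` satisfies `v (u / y ^ a * δ x) < 1` at every place, where
`δ` is the Euler derivation of an element generating the value group of `K(x)`. -/
theorem valuation_lt_one_of_mem [Fact p.Prime] [CharP K p] [PerfectRing K p]
    (h : IsSuperelliptic p q k z Λ y) {a : ℕ} {u : RatFunc K}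
    (hu : diffForm K L y a u ∈ regularForms K L) {O : ValuationSubring L}
    (hO : ∀ c : K, algebraMap K L c ∈ O) {w : L} (h0 : w ≠ 0) (h1 : O.valuation w < 1)
    (hw : ∀ g : K[X], g ≠ 0 →
      ∃ k : ℤ, O.valuation (aeval (algebraMap (RatFunc K) L RatFunc.X) g) = O.valuation w ^ k)
    (δ : Derivation K L L) (hδ : δ w = w) :
    O.valuation (algebraMap (RatFunc K) L u * (y ^ a)⁻¹ *
      δ (algebraMap (RatFunc K) L RatFunc.X)) < 1 := by
  have : CharP L p := charP_of_injective_algebraMap (algebraMap K L).injective p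
  have := h.finiteDimensional
  obtain ⟨hfd, hfin⟩ := finrank_powSubfield_le (p := p) (q := q)
    ((Nat.coprime_primes Fact.out h.prime).mpr h.lt.ne') h.adjoin_eq_top h.y_ne_zero h.pow_eq
  refine valuation_mul_derivation_lt_one p hfin O h0 ?_ δ hδ (hu O hO)
  refine valuation_ne_pow (F := RatFunc K) O.valuation (h.finrank_le.trans_lt h.lt) h0 h1 ?_
  refine exists_valuation_algebraMap_eq_zpow (O.valuation.ne_zero_iff.mpr h0) fun g hg => ?_
  rw [algebraMap_ratFunc_eq_aeval]
  exact hw g hg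

theorem pow_eq_aeval (h : IsSuperelliptic p q k z Λ y) :
    y ^ q = aeval (algebraMap (RatFunc K) L RatFunc.X) (∏ j, (X - C (z j)) ^ Λ j) := by
  rw [h.pow_eq, algebraMap_ratFunc_eq_aeval]

/-- If `u / B` has a pole at an irreducible `π`, test regularity at a place above `π` with the Euler
derivation `(π / π') d/dx`. Here `π'` is a unit at the place because `K` is perfect. The test gives
`v(u π) ^ q < v(F) ^ a` for `F = ∏ (x - z_j) ^ Λ_j`. But the pole gives `v(B) ≤ v(u π)`, and `q ⌊Λ_j
a / q⌋ ≤ Λ_j a` gives `v(F) ^ a ≤ v(B) ^ q`. -/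
theorem exists_polynomial_of_mem [Fact p.Prime] [CharP K p] [PerfectRing K p]
    (h : IsSuperelliptic p q k z Λ y) {a : ℕ} {u : RatFunc K}
    (hu : diffForm K L y a u ∈ regularForms K L) :
    ∃ g : K[X], u = algebraMap K[X] (RatFunc K) ((∏ j, (X - C (z j)) ^ (Λ j * a / q)) * g) := by
  set x := algebraMap (RatFunc K) L RatFunc.X with hx
  set B := ∏ j, (X - C (z j)) ^ (Λ j * a / q) with hB
  have hB0 : algebraMap K[X] (RatFunc K) B ≠ 0 := algebraMap_prod_ne_zero z _
  set g := u / algebraMap K[X] (RatFunc K) B with hg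
  have hug : u = algebraMap K[X] (RatFunc K) B * g := by rw [hg, mul_div_cancel₀ _ hB0]
  by_cases hunit : IsUnit g.denom
  · refine ⟨g.num, ?_⟩
    have h1 : g.denom = 1 := g.monic_denom.eq_one_of_isUnit hunit
    have h2 := RatFunc.num_div_denom g
    rw [h1, map_one, div_one] at h2
    rw [hug, map_mul, h2]
  exfalso
  obtain ⟨π, hπ, hπd⟩ := WfDvdMonoid.exists_irreducible_factor hunit g.denom_ne_zero
  have hπn : ¬ π ∣ g.num := fun hd =>
    hπ.not_isUnit (g.isCoprime_num_denom.isUnit_of_dvd' hd hπd)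
  have : PerfectField K := PerfectRing.toPerfectField K p
  have hπ' : ¬ π ∣ derivative π := fun hd =>
    hπ.not_isUnit ((PerfectField.separable_of_irreducible hπ).isUnit_of_dvd' dvd_rfl hd)
  let f : K[X] →+* L := (aeval x : K[X] →ₐ[K] L).toRingHom
  have hf : Function.Injective f := aeval_ratFunc_X_injective K L
  obtain ⟨O, hO, hv⟩ := exists_valuationSubring_of_not_isUnit f hf hπ.not_isUnit
  have hle : ∀ g, O.valuation (f g) ≤ 1 := fun g => (O.valuation_le_one_iff _).mpr (hO g)
  have h0 : f π ≠ 0 := (map_ne_zero_iff f hf).mpr hπ.ne_zero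
  have := h.isSeparable
  obtain ⟨D, hD⟩ := exists_derivation_eq_one K L
  have hvπ' : O.valuation (f (derivative π)) = 1 := valuation_eq_one_of_not_dvd hO hπ hv hπ'
  have h0' : f (derivative π) ≠ 0 := by
    intro h; rw [h, map_zero] at hvπ'; exact zero_ne_one hvπ'
  have key := h.valuation_lt_one_of_mem hu (O := O) (fun c => by simpa [f] using hO (C c)) h0 hv
    (fun g hg => by
      obtain ⟨k, hk, -⟩ := exists_valuation_eq_pow hO hπ hv hg
      exact ⟨k, by rw [zpow_natCast]; exact hk⟩)
    ((f π / f (derivative π)) • D) (by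
      have : D (f π) = f (derivative π) • D x := D.map_aeval π x
      rw [Derivation.smul_apply, this, hD, smul_eq_mul, smul_eq_mul, mul_one,
        div_mul_cancel₀ _ h0'])
  rw [Derivation.smul_apply, hD, smul_eq_mul, mul_one] at key
  -- Passing to `q`-th powers replaces `v y` by the value of a polynomial in `x`, so the
  -- ramification above `π` never has to be known.
  refine absurd (pow_lt_one₀ zero_le key h.prime.ne_zero) (not_lt.mpr ?_)
  have hvy : O.valuation (y ^ a)⁻¹ ^ q = (O.valuation (f (∏ j, (X - C (z j)) ^ Λ j)) ^ a)⁻¹ := by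
    rw [map_inv₀, map_pow, inv_pow, ← pow_mul, mul_comm, pow_mul, ← map_pow, h.pow_eq_aeval]
    rfl
  obtain ⟨l, hl, hl1⟩ := exists_valuation_eq_pow hO hπ hv g.denom_ne_zero
  have hug' : algebraMap (RatFunc K) L u * f g.denom = f B * f g.num := by
    have h1 := RatFunc.num_div_denom g
    rw [div_eq_iff (by
      exact (map_ne_zero_iff _ (RatFunc.algebraMap_injective K)).mpr g.denom_ne_zero)] at h1
    have h2 := congrArg (algebraMap (RatFunc K) L) h1
    rw [map_mul, algebraMap_ratFunc_eq_aeval, algebraMap_ratFunc_eq_aeval] at h2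
    rw [hug, map_mul, algebraMap_ratFunc_eq_aeval, mul_assoc]
    exact congrArg (f B * ·) h2.symm
  have hvu : O.valuation (f B) ≤ O.valuation (algebraMap (RatFunc K) L u) * O.valuation (f π) := by
    have h1 := congrArg O.valuation hug'
    rw [map_mul, map_mul, hl, valuation_eq_one_of_not_dvd hO hπ hv hπn, mul_one] at h1
    rw [← h1]
    gcongr
    exact pow_le_of_le_one zero_le (hle _) (by have := hl1 hπd; omega)
  have hvB : O.valuation (f (∏ j, (X - C (z j)) ^ Λ j)) ^ a ≤ O.valuation (f B) ^ q := by
    simp only [hB, map_prod, map_pow, ← Finset.prod_pow, ← pow_mul]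
    refine Finset.prod_le_prod (fun _ _ => zero_le) fun j _ => ?_
    refine pow_le_pow_right_of_le_one' (hle _) ?_
    exact Nat.div_mul_le_self _ _
  have hF0 : O.valuation (f (∏ j, (X - C (z j)) ^ Λ j)) ^ a ≠ 0 :=
    pow_ne_zero _ (O.valuation.ne_zero_iff.mpr ((map_ne_zero_iff f hf).mpr (prod_monic z Λ).ne_zero))
  have e : O.valuation (algebraMap (RatFunc K) L u * (y ^ a)⁻¹ * (f π / f (derivative π))) ^ q =
      (O.valuation (algebraMap (RatFunc K) L u) * O.valuation (f π)) ^ q *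
        (O.valuation (f (∏ j, (X - C (z j)) ^ Λ j)) ^ a)⁻¹ := by
    rw [map_mul, map_mul, map_div₀, hvπ', div_one, mul_pow, mul_pow, mul_pow, hvy,
      mul_right_comm]
  rw [e, ← mul_inv_cancel₀ hF0]
  exact mul_le_mul' (hvB.trans (pow_le_pow_left' hvu q)) le_rfl

/-- The same test at a place above infinity, with `w = 1 / x` and `δ = -x d/dx`. Taking `q`-th
powers yields `(deg U + 1) q < (k q + 1) a`, which together with `a < q` forces `deg U < a k`. -/
theorem degree_lt_of_mem [Fact p.Prime] [CharP K p] [PerfectRing K p]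
    (h : IsSuperelliptic p q k z Λ y) {a : ℕ} (ha : a < q) {U : K[X]}
    (hu : diffForm K L y a (algebraMap K[X] (RatFunc K) U) ∈ regularForms K L) :
    U.degree < (a * k : ℕ) := by
  by_cases hU : U = 0
  · rw [hU, degree_zero]; exact WithBot.bot_lt_coe _
  rw [degree_eq_natDegree hU, Nat.cast_lt]
  set x := algebraMap (RatFunc K) L RatFunc.X with hx
  have hx0 : x ≠ 0 := (_root_.map_ne_zero _).mpr RatFunc.X_ne_zero
  let f : K[X] →+* L := (aeval x⁻¹ : K[X] →ₐ[K] L).toRingHom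
  have hf : Function.Injective f := by
    have htr : Transcendental K x :=
      transcendental_iff_injective.mpr (aeval_ratFunc_X_injective K L)
    have : Transcendental K x⁻¹ := fun halg => htr (by simpa using halg.inv)
    exact transcendental_iff_injective.mp this
  have hfX : f X = x⁻¹ := aeval_X _
  obtain ⟨O, hO, hv⟩ := exists_valuationSubring_of_not_isUnit f hf (not_isUnit_X (R := K))
  set γ := O.valuation (f X) with hγ
  have hγ0 : γ ≠ 0 := O.valuation.ne_zero_iff.mpr ((map_ne_zero_iff f hf).mpr X_ne_zero)
  have hvx : O.valuation x = γ⁻¹ := by rw [hγ, hfX, map_inv₀, inv_inv]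
  -- Write `g(x)` as `x ^ deg g` times the reversed polynomial at `1 / x`; the latter has nonzero
  -- constant term, hence is a unit at the place.
  have hval : ∀ g : K[X], g ≠ 0 → O.valuation (aeval x g) = γ⁻¹ ^ g.natDegree := by
    intro g hg
    let := invertibleOfNonzero hx0
    have h1 := eval₂_reverse_mul_pow (algebraMap K L) x g
    rw [invOf_eq_inv] at h1
    change f g.reverse * _ = aeval x g at h1
    rw [← h1, map_mul, map_pow, hvx, valuation_eq_one_of_not_dvd hO irreducible_X hv, one_mul]
    rw [X_dvd_iff, coeff_zero_reverse]
    exact leadingCoeff_ne_zero.mpr hg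
  have := h.isSeparable
  obtain ⟨D, hD⟩ := exists_derivation_eq_one K L
  have key := h.valuation_lt_one_of_mem hu (O := O) (fun c => by simpa [f] using hO (C c))
    (inv_ne_zero hx0) (by rw [← hfX]; exact hv)
    (fun g hg => ⟨-(g.natDegree : ℤ), by
      rw [hval g hg, ← hfX, zpow_neg, zpow_natCast, inv_pow]⟩)
    ((-x) • D) (by
      rw [Derivation.smul_apply, Derivation.leibniz_inv, hD, smul_eq_mul, smul_eq_mul]
      field_simp)
  rw [Derivation.smul_apply, hD, smul_eq_mul, mul_one, algebraMap_ratFunc_eq_aeval] at key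
  have h1 := pow_lt_one₀ zero_le key h.prime.ne_zero
  have hvy : O.valuation (y ^ a)⁻¹ ^ q = γ ^ ((k * q + 1) * a) := by
    rw [map_inv₀, map_pow, inv_pow, ← pow_mul, mul_comm a, pow_mul, ← map_pow, h.pow_eq_aeval,
      hval _ (prod_monic z Λ).ne_zero, natDegree_prod, h.sum_eq, inv_pow, inv_pow, inv_inv,
      ← pow_mul]
  rw [map_mul, map_mul, Valuation.map_neg, hvx, hval U hU, mul_pow, mul_pow, hvy, mul_right_comm,
    ← mul_pow, ← pow_succ, ← pow_mul, inv_pow, inv_mul_lt_iff₀ (zero_lt_iff.mpr (pow_ne_zero _ hγ0)),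
    mul_one] at h1
  have h2 : (U.natDegree + 1) * q < (k * q + 1) * a := by
    by_contra! h3
    exact absurd (pow_le_pow_right_of_le_one' hv.le h3) (not_le.mpr h1)
  by_contra! h3
  have : (a * k + 1) * q ≤ (U.natDegree + 1) * q := Nat.mul_le_mul_right _ (by omega)
  nlinarith

end IsSuperelliptic

/-! ### Regularity of explicit differentials -/

section Regular

variable {K L : Type*} [Field K] [Field L] [Algebra K L] {O : ValuationSubring L}

theorem aeval_mem_valuationSubring (hO : ∀ c : K, algebraMap K L c ∈ O) {x : L}
    (hx : x ∈ O) (P : K[X]) : aeval x P ∈ O := by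
  rw [aeval_eq_sum_range]
  refine sum_mem fun i _ => ?_
  rw [Algebra.smul_def]
  exact mul_mem (hO _) (pow_mem hx _)

theorem IsRegularAt.smul {ω : Ω[L⁄K]} (h : IsRegularAt K L O ω) {c : L} (hc : c ∈ O) :
    IsRegularAt K L O (c • ω) :=
  Submodule.smul_mem _ (⟨c, hc⟩ : O) h

theorem isRegularAt_D {f : L} (hf : f ∈ O) : IsRegularAt K L O (KaehlerDifferential.D K L f) :=
  Submodule.subset_span ⟨f, hf, rfl⟩

/-- Regularity at a totally ramified point: here `s` is a uniformizer downstairs and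
`y ^ q = c s ^ Λ` with a unit `c`. -/
theorem isRegularAt_of_ramified {q Λ a e : ℕ} (hq : 1 < q) (hΛ : Λ.Coprime q) {s y c c' : L}
    (hs0 : s ≠ 0) (hs : O.valuation s < 1) (hc : O.valuation c = 1) (hc' : c' ∈ O)
    (hD : KaehlerDifferential.D K L c = c' • KaehlerDifferential.D K L s)
    (hy : y ^ q = c * s ^ Λ) (hae : a * Λ < q * e + q) :
    IsRegularAt K L O ((s ^ e * (y ^ a)⁻¹) • KaehlerDifferential.D K L s) := by
  have hq0 : q ≠ 0 := by omega
  -- Since `Λ α - q β = 1`, the element `t = y ^ α / s ^ β` satisfies `t ^ q = s c ^ α`: it plays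
  -- the role of a uniformizer, with `v s = v t ^ q` and `v y = v t ^ Λ`.
  obtain ⟨α, -, hα⟩ := Nat.exists_mul_mod_eq_one_of_coprime hΛ hq
  set β := Λ * α / q with hβ
  have hαβ : Λ * α = q * β + 1 := by rw [← hα]; exact (Nat.div_add_mod _ _).symm
  set t : L := y ^ α / s ^ β with ht
  have htq : t ^ q = s * c ^ α := by
    rw [ht, div_pow, ← pow_mul, mul_comm α, pow_mul, hy, mul_pow, ← pow_mul, hαβ, ← pow_mul,
      mul_comm β, div_eq_iff (pow_ne_zero _ hs0)]
    ring
  have hvtq : O.valuation t ^ q = O.valuation s := by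
    rw [← map_pow, htq, map_mul, map_pow, hc, one_pow, mul_one]
  have hvs : O.valuation s ≠ 0 := O.valuation.ne_zero_iff.mpr hs0
  have hvt0 : O.valuation t ≠ 0 := by
    intro h; rw [h, zero_pow hq0] at hvtq; exact hvs hvtq.symm
  have hvt : O.valuation t < 1 := by
    by_contra! h
    exact absurd (hvtq ▸ one_le_pow_of_one_le' h q) (not_le.mpr hs)
  have hvy : O.valuation y = O.valuation t ^ Λ := by
    refine (pow_left_inj₀ zero_le zero_le hq0).mp ?_
    rw [← map_pow, hy, map_mul, hc, one_mul, map_pow, ← hvtq, ← pow_mul, ← pow_mul, mul_comm]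
  -- Differentiating `t ^ q = s c ^ α` gives `ε ds = q t ^ (q - 1) dt`, and `ε` is a unit because
  -- `s` lies in the maximal ideal. The differential then has order at least `q e + q - 1 - Λ a` in
  -- `t`.
  set ε := c ^ α + s * (α * c ^ (α - 1) * c') with hε
  have hO : ∀ n : ℕ, O.valuation (n : L) ≤ 1 := fun n => (O.valuation_le_one_iff _).mpr (natCast_mem O n)
  have hvε : O.valuation ε = 1 := by
    rw [hε, O.valuation.map_add_eq_of_lt_left, map_pow, hc, one_pow]
    rw [map_pow, hc, one_pow, map_mul, map_mul, map_mul, map_pow, hc, one_pow, mul_one]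
    calc _ ≤ O.valuation s * (1 * 1) := by
          gcongr
          · exact hO α
          · exact (O.valuation_le_one_iff _).mpr hc'
      _ < 1 := by rwa [mul_one, mul_one]
  have hε0 : ε ≠ 0 := by
    intro h; rw [h, map_zero] at hvε; exact zero_ne_one hvε
  have hDs : ε • KaehlerDifferential.D K L s =
      ((q : L) * t ^ (q - 1)) • KaehlerDifferential.D K L t := by
    have h1 := congrArg (KaehlerDifferential.D K L) htq
    rw [Derivation.leibniz_pow, Derivation.leibniz, Derivation.leibniz_pow, hD] at h1
    rw [mul_smul, Nat.cast_smul_eq_nsmul, h1, ← Nat.cast_smul_eq_nsmul L, smul_smul, smul_smul,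
      smul_smul, ← add_smul, hε, add_comm]
    congr 2
    ring
  have hDs' : KaehlerDifferential.D K L s =
      (ε⁻¹ * ((q : L) * t ^ (q - 1))) • KaehlerDifferential.D K L t := by
    rw [mul_smul, ← hDs, smul_smul, inv_mul_cancel₀ hε0, one_smul]
  rw [hDs', smul_smul]
  refine (isRegularAt_D ((O.valuation_le_one_iff t).mp hvt.le)).smul ?_
  rw [← O.valuation_le_one_iff, map_mul, map_mul, map_mul, map_mul, map_inv₀, map_inv₀, hvε,
    inv_one, one_mul, map_pow, map_pow, map_pow, hvy, ← hvtq, ← pow_mul, ← pow_mul]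
  calc _ ≤ O.valuation t ^ (q * e) * (O.valuation t ^ (Λ * a))⁻¹ *
        (1 * O.valuation t ^ (q - 1)) := by
        gcongr
        exact hO q
    _ = O.valuation t ^ (q * e + (q - 1)) * (O.valuation t ^ (Λ * a))⁻¹ := by
        rw [one_mul, mul_right_comm, ← pow_add]
    _ ≤ O.valuation t ^ (Λ * a) * (O.valuation t ^ (Λ * a))⁻¹ := by
        refine mul_le_mul' (pow_le_pow_right_of_le_one' hvt.le ?_) le_rfl
        rw [mul_comm Λ]
        omega
    _ = 1 := mul_inv_cancel₀ (pow_ne_zero _ hvt0)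

end Regular

namespace IsSuperelliptic

variable {K L : Type*} [Field K] [Field L] [Algebra K L] [Algebra (RatFunc K) L]
  [IsScalarTower K (RatFunc K) L] {ι : Type*} [Fintype ι] {p q k : ℕ} {z : ι → K} {Λ : ι → ℕ}
  {y : L}

/-- If `y` is a unit at the place, the coefficient of `dx` is integral. Otherwise some `x - z_j`
lies in the maximal ideal, the remaining factors of `y ^ q` are units because the `z_i` are
distinct, and the place is totally ramified. -/
theorem isRegularAt_finite (h : IsSuperelliptic p q k z Λ y) (a : ℕ) (g : K[X])
    {O : ValuationSubring L} (hO : ∀ c : K, algebraMap K L c ∈ O)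
    (hx : algebraMap (RatFunc K) L RatFunc.X ∈ O) :
    IsRegularAt K L O (diffForm K L y a
      (algebraMap K[X] (RatFunc K) ((∏ j, (X - C (z j)) ^ (Λ j * a / q)) * g))) := by
  classical
  set x := algebraMap (RatFunc K) L RatFunc.X
  change IsRegularAt K L O ((_ * (y ^ a)⁻¹) • KaehlerDifferential.D K L x)
  rw [algebraMap_ratFunc_eq_aeval]
  have hmem := aeval_mem_valuationSubring hO hx
  have hle : ∀ g, O.valuation (aeval x g) ≤ 1 := fun g => (O.valuation_le_one_iff _).mpr (hmem g)
  have hyq := congrArg O.valuation h.pow_eq_aeval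
  rw [map_pow] at hyq
  have hy1 : O.valuation y ≤ 1 := by
    by_contra! h1
    exact absurd (hyq ▸ one_lt_pow₀ h1 h.prime.ne_zero) (not_lt.mpr (hle _))
  rcases hy1.eq_or_lt with hy1 | hy1
  · refine (isRegularAt_D hx).smul (mul_mem (hmem _) ?_)
    rw [← O.valuation_le_one_iff, map_inv₀, map_pow, hy1, one_pow, inv_one]
  obtain ⟨j, hj⟩ : ∃ j, O.valuation (aeval x (X - C (z j))) < 1 := by
    by_contra! h1
    have h2 : O.valuation (aeval x (∏ j, (X - C (z j)) ^ Λ j)) = 1 := by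
      rw [map_prod, map_prod]
      refine Finset.prod_eq_one fun j _ => ?_
      rw [map_pow, map_pow, (hle _).antisymm (h1 j), one_pow]
    rw [h2] at hyq
    exact absurd hyq (pow_lt_one₀ zero_le hy1 h.prime.ne_zero).ne
  set s := aeval x (X - C (z j)) with hs
  have hs0 : s ≠ 0 := (map_ne_zero_iff _ (aeval_ratFunc_X_injective K L)).mpr (X_sub_C_ne_zero _)
  have hDs : KaehlerDifferential.D K L s = KaehlerDifferential.D K L x := by
    rw [hs, Derivation.map_aeval, derivative_X_sub_C, map_one, one_smul]
  set c₀ := ∏ i ∈ Finset.univ.erase j, (X - C (z i)) ^ Λ i with hc₀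
  have hc : O.valuation (aeval x c₀) = 1 := by
    refine valuation_eq_one_of_not_dvd (f := (aeval x : K[X] →ₐ[K] L).toRingHom) hmem
      (irreducible_X_sub_C (z j)) hj ?_
    rw [dvd_iff_isRoot, IsRoot, hc₀, eval_prod, Finset.prod_eq_zero_iff]
    rintro ⟨i, hi, hi0⟩
    rw [eval_pow, eval_sub, eval_X, eval_C] at hi0
    exact (Finset.mem_erase.mp hi).1 (h.injective (sub_eq_zero.mp (eq_zero_of_pow_eq_zero hi0)).symm)
  have key := isRegularAt_of_ramified (K := K) (a := a) (e := Λ j * a / q) h.prime.one_lt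
    (h.coprime j) hs0 hj hc (hmem (derivative c₀)) (by rw [hDs, Derivation.map_aeval]) (y := y) (by
      rw [h.pow_eq_aeval, ← Finset.mul_prod_erase _ _ (Finset.mem_univ j), map_mul, map_pow,
        mul_comm]) (by
      have := Nat.div_add_mod (Λ j * a) q
      have := Nat.mod_lt (Λ j * a) h.prime.pos
      rw [mul_comm a]
      omega)
  rw [hDs] at key
  have := key.smul (hmem ((∏ i ∈ Finset.univ.erase j, (X - C (z i)) ^ (Λ i * a / q)) * g))
  rw [smul_smul] at this
  convert this using 2
  rw [← Finset.mul_prod_erase _ _ (Finset.mem_univ j), map_mul, map_mul, map_mul, map_pow]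
  ring

/-- With `s = 1 / x`, the function `y s ^ (k + 1)` has `q`-th power equal to a unit times `s ^ (q -
1)`, so infinity is totally ramified as well. Regularity there leaves the factor `U s ^ (a k - 1)`,
which is integral by the degree bound. -/
theorem isRegularAt_infinite (h : IsSuperelliptic p q k z Λ y) {a : ℕ} (ha : 1 ≤ a) {U : K[X]}
    (hU : U.degree < (a * k : ℕ)) {O : ValuationSubring L} (hO : ∀ c : K, algebraMap K L c ∈ O)
    (hx : algebraMap (RatFunc K) L RatFunc.X ∉ O) :
    IsRegularAt K L O (diffForm K L y a (algebraMap K[X] (RatFunc K) U)) := by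
  set x := algebraMap (RatFunc K) L RatFunc.X
  change IsRegularAt K L O ((_ * (y ^ a)⁻¹) • KaehlerDifferential.D K L x)
  rw [algebraMap_ratFunc_eq_aeval]
  have hx0 : x ≠ 0 := by rintro h0; exact hx (h0 ▸ O.zero_mem)
  set s := x⁻¹ with hs
  have hs0 : s ≠ 0 := inv_ne_zero hx0
  have hxs : x = s⁻¹ := (inv_inv x).symm
  have hvs : O.valuation s < 1 := by
    rw [hs, map_inv₀]
    exact inv_lt_one_of_one_lt₀ (not_le.mp fun h1 => hx ((O.valuation_le_one_iff x).mp h1))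
  have hsO : s ∈ O := (O.valuation_le_one_iff s).mp hvs.le
  have hmem := aeval_mem_valuationSubring hO hsO
  set c₀ : K[X] := ∏ j, (1 - C (z j) * X) ^ Λ j with hc₀
  have hc : O.valuation (aeval s c₀) = 1 := by
    refine valuation_eq_one_of_not_dvd (f := (aeval s : K[X] →ₐ[K] L).toRingHom) hmem
      irreducible_X (by change O.valuation (aeval s X) < 1; rwa [aeval_X]) ?_
    rw [X_dvd_iff, coeff_zero_eq_eval_zero, hc₀, eval_prod]
    simp
  have hF : y ^ q = aeval s c₀ * x ^ (k * q + 1) := by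
    rw [h.pow_eq_aeval, ← h.sum_eq, ← Finset.prod_pow_eq_pow_sum, hc₀, map_prod, map_prod,
      ← Finset.prod_mul_distrib]
    refine Finset.prod_congr rfl fun j _ => ?_
    rw [map_pow, map_pow, ← mul_pow]
    congr 1
    simp only [map_sub, aeval_X, aeval_C, map_one, map_mul]
    rw [sub_mul, one_mul, mul_assoc, hs, inv_mul_cancel₀ hx0, mul_one]
  have hq1 := h.prime.one_lt
  have key := isRegularAt_of_ramified (K := K) (Λ := q - 1) (a := a) (e := a - 1) hq1
    (by
      rw [Nat.coprime_comm]
      exact (Nat.coprime_self_sub_right hq1.le).mpr (Nat.coprime_one_right q)) hs0 hvs hc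
    (hmem (derivative c₀)) (by rw [Derivation.map_aeval]) (y := y * s ^ (k + 1)) (by
      obtain ⟨r, rfl⟩ : ∃ r, q = r + 1 := ⟨q - 1, by omega⟩
      rw [mul_pow, hF, mul_assoc, hxs, Nat.add_sub_cancel, inv_pow, ← pow_mul,
        inv_mul_eq_iff_eq_mul₀ (pow_ne_zero _ hs0)|>.mpr]
      ring) (by
      obtain ⟨r, rfl⟩ : ∃ r, q = r + 1 := ⟨q - 1, by omega⟩
      obtain ⟨b, rfl⟩ : ∃ b, a = b + 1 := ⟨a - 1, by omega⟩
      simp only [Nat.add_sub_cancel]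
      nlinarith)
  have hak : 1 ≤ a * k := Nat.mul_pos ha h.pos
  have hU' : aeval x U * s ^ (a * k - 1) ∈ O := by
    rw [aeval_eq_sum_range, Finset.sum_mul]
    refine sum_mem fun i hi => ?_
    have hi' : U.coeff i = 0 ∨ i ≤ a * k - 1 := by
      by_cases h0 : U.coeff i = 0
      · exact Or.inl h0
      · have := (le_degree_of_ne_zero h0).trans_lt hU
        rw [Nat.cast_lt] at this
        right; omega
    rcases hi' with h0 | h0
    · rw [h0, zero_smul, zero_mul]; exact O.zero_mem
    · obtain ⟨d, hd⟩ := Nat.exists_eq_add_of_le h0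
      rw [Algebra.smul_def, mul_assoc, hd, pow_add, ← mul_assoc (x ^ i), ← mul_pow, hs,
        mul_inv_cancel₀ hx0, one_pow, one_mul]
      exact mul_mem (hO _) (pow_mem hsO _)
  have := (key.smul hU').smul (neg_mem O.one_mem)
  rw [smul_smul, smul_smul] at this
  have hDx : KaehlerDifferential.D K L x = (-(x ^ 2)) • KaehlerDifferential.D K L s := by
    conv_lhs => rw [hxs, Derivation.leibniz_inv]
    rw [hs, inv_inv]
  rw [hDx, smul_smul]
  convert this using 2
  have hy0 := h.y_ne_zero
  obtain ⟨b, rfl⟩ : ∃ b, a = b + 1 := ⟨a - 1, by omega⟩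
  obtain ⟨r, rfl⟩ : ∃ r, k = r + 1 := ⟨k - 1, by have := h.pos; omega⟩
  have : (b + 1) * (r + 1) - 1 = b * r + b + r := by
    rw [show (b + 1) * (r + 1) = b * r + b + r + 1 by ring, Nat.add_sub_cancel]
  rw [this, Nat.add_sub_cancel, mul_pow]
  generalize aeval x U = V
  rw [hxs]
  field_simp
  ring

/-- The differential `u dx / y ^ a` is regular if and only if `u` is a polynomial of degree less
than `a k` which is divisible by `(x - z_j) ^ ⌊Λ_j a / q⌋` for all `j`. -/
theorem diffForm_mem_regularForms_iff [Fact p.Prime] [CharP K p] [PerfectRing K p]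
    (h : IsSuperelliptic p q k z Λ y) {a : ℕ} (ha : 1 ≤ a ∧ a < q) (u : RatFunc K) :
    diffForm K L y a u ∈ regularForms K L ↔ ∃ g : K[X],
      u = algebraMap K[X] (RatFunc K) ((∏ j, (X - C (z j)) ^ (Λ j * a / q)) * g) ∧
      ((∏ j, (X - C (z j)) ^ (Λ j * a / q)) * g).degree < (a * k : ℕ) := by
  constructor
  · intro hu
    obtain ⟨g, rfl⟩ := h.exists_polynomial_of_mem hu
    exact ⟨g, rfl, h.degree_lt_of_mem ha.2 hu⟩
  · rintro ⟨g, rfl, hg⟩ O hO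
    by_cases hx : algebraMap (RatFunc K) L RatFunc.X ∈ O
    · exact h.isRegularAt_finite a g hO hx
    · exact h.isRegularAt_infinite ha.1 hg hO hx

end IsSuperelliptic

/-! ### The space of regular differentials of type `a` in coordinates -/

section PolyForm

variable {K L : Type*} [Field K] [Field L] [Algebra K L] [Algebra (RatFunc K) L]
  [IsScalarTower K (RatFunc K) L]

/-- The differential `U(x) dx / y ^ a`, as a linear function of the polynomial `U`. -/
noncomputable def polyForm (y : L) (a : ℕ) : K[X] →ₗ[K] Ω[L⁄K] :=
  diffForm K L y a ∘ₗ (IsScalarTower.toAlgHom K K[X] (RatFunc K)).toLinearMap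

theorem polyForm_apply (y : L) (a : ℕ) (U : K[X]) :
    polyForm y a U = diffForm K L y a (algebraMap K[X] (RatFunc K) U) := rfl

theorem polyForm_eq_sum (y : L) (a : ℕ) {N : ℕ} {U : K[X]} (hU : U.degree < N) :
    polyForm y a U = ∑ l : Fin N, U.coeff l • diffForm K L y a (RatFunc.X ^ (l : ℕ)) := by
  have h1 : U = ∑ l : Fin N, U.coeff l • (X ^ (l : ℕ) : K[X]) := by
    simp only [smul_X_eq_monomial]
    rw [sum_fin (fun e c => monomial e c) (by simp) hU, sum_monomial_eq]
  conv_lhs => rw [h1]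
  rw [map_sum]
  refine Finset.sum_congr rfl fun l _ => ?_
  rw [map_smul, polyForm_apply, map_pow, RatFunc.algebraMap_X]

end PolyForm

namespace IsSuperelliptic

variable {K L : Type*} [Field K] [Field L] [Algebra K L] [Algebra (RatFunc K) L]
  [IsScalarTower K (RatFunc K) L] {ι : Type*} [Fintype ι] {p q k a d : ℕ} {z : ι → K} {Λ : ι → ℕ}
  {y : L} [CharP K p]

theorem polyForm_injective (h : IsSuperelliptic p q k z Λ y) (a : ℕ) :
    Function.Injective (polyForm (K := K) y a) := by
  have := h.isSeparable
  exact (diffForm_injective h.y_ne_zero a).comp (RatFunc.algebraMap_injective K)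

theorem degree_prod_mul_lt_iff (hd : a * k = (∑ j, Λ j * a / q) + d) (g : K[X]) :
    ((∏ j, (X - C (z j)) ^ (Λ j * a / q)) * g).degree < (a * k : ℕ) ↔ g.degree < d := by
  have hB := prod_monic z fun j => Λ j * a / q
  by_cases hg : g = 0
  · rw [hg, mul_zero, degree_zero]
    exact iff_of_true (WithBot.bot_lt_coe _) (WithBot.bot_lt_coe _)
  rw [degree_mul, degree_eq_natDegree hB.ne_zero, natDegree_prod, degree_eq_natDegree hg, hd,
    ← Nat.cast_add, Nat.cast_lt, Nat.cast_lt]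
  omega

/-- The differentials `dx / (y (x - z_j))` are linearly independent. -/
theorem linearIndependent_diffForm_inv [DecidableEq ι] (h : IsSuperelliptic p q k z Λ y) (a : ℕ) :
    LinearIndependent K fun j =>
      diffForm K L y a (algebraMap K[X] (RatFunc K) (X - C (z j)))⁻¹ := by
  have := h.isSeparable
  refine LinearIndependent.map' ?_ (diffForm K L y a)
    (LinearMap.ker_eq_bot.mpr (diffForm_injective h.y_ne_zero a))
  rw [Fintype.linearIndependent_iff]
  intro c hc j
  have h1 : algebraMap K[X] (RatFunc K)
      (∑ i, C (c i) * ∏ l ∈ Finset.univ.erase i, (X - C (z l))) = 0 := by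
    have h2 := congrArg (algebraMap K[X] (RatFunc K) (∏ l, (X - C (z l))) * ·) hc
    simp only [mul_zero, Finset.mul_sum] at h2
    rw [← h2, map_sum]
    refine Finset.sum_congr rfl fun i _ => ?_
    have h3 : algebraMap K[X] (RatFunc K) (X - C (z i)) ≠ 0 :=
      (map_ne_zero_iff _ (RatFunc.algebraMap_injective K)).mpr (X_sub_C_ne_zero _)
    rw [← Finset.mul_prod_erase _ _ (Finset.mem_univ i), map_mul, map_mul, Algebra.smul_def,
      IsScalarTower.algebraMap_apply K K[X] (RatFunc K), algebraMap_eq, mul_mul_mul_comm,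
      mul_comm _ (algebraMap K[X] (RatFunc K) (C (c i))), mul_mul_mul_comm,
      mul_inv_cancel₀ h3]
    ring
  rw [map_eq_zero_iff _ (RatFunc.algebraMap_injective K)] at h1
  have h2 := congrArg (eval (z j)) h1
  rw [eval_finsetSum, Finset.sum_eq_single j, eval_mul, eval_C, eval_prod, eval_zero] at h2
  · refine (mul_eq_zero.mp h2).resolve_right (Finset.prod_ne_zero_iff.mpr fun i hi => ?_)
    rw [eval_sub, eval_X, eval_C]
    exact sub_ne_zero.mpr fun he => (Finset.mem_erase.mp hi).1 (h.injective he).symm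
  · intro i _ hij
    rw [eval_mul, eval_prod, Finset.prod_eq_zero (Finset.mem_erase.mpr ⟨hij.symm, Finset.mem_univ j⟩),
      mul_zero]
    simp
  · simp

variable [Fact p.Prime] [PerfectRing K p]

theorem mem_regularFormsOfType_iff (h : IsSuperelliptic p q k z Λ y) (ha : 1 ≤ a ∧ a < q)
    (hd : a * k = (∑ j, Λ j * a / q) + d) (ω : Ω[L⁄K]) :
    ω ∈ regularFormsOfType K L y a ↔ ∃ g : K[X], g.degree < d ∧
      polyForm y a ((∏ j, (X - C (z j)) ^ (Λ j * a / q)) * g) = ω := by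
  constructor
  · rintro ⟨hω, u, rfl⟩
    obtain ⟨g, hg, hdeg⟩ := (h.diffForm_mem_regularForms_iff ha u).mp hω
    exact ⟨g, (degree_prod_mul_lt_iff hd g).mp hdeg, by rw [hg, polyForm_apply]⟩
  · rintro ⟨g, hdeg, rfl⟩
    exact ⟨(h.diffForm_mem_regularForms_iff ha _).mpr
      ⟨g, rfl, (degree_prod_mul_lt_iff hd g).mpr hdeg⟩, _, rfl⟩

/-- `Ω¹_a(X)` is the space of the differentials `∏ (x - z_j) ^ ⌊Λ_j a / q⌋ g(x) dx / y ^ a`, where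
`g` is a polynomial of degree less than `d = a k - e(a)`. -/
noncomputable def degreeLTEquivForms (h : IsSuperelliptic p q k z Λ y) (ha : 1 ≤ a ∧ a < q)
    (hd : a * k = (∑ j, Λ j * a / q) + d) :
    degreeLT K d ≃ₗ[K] regularFormsOfType K L y a :=
  LinearEquiv.ofBijective
    (LinearMap.codRestrict (regularFormsOfType K L y a)
      (polyForm y a ∘ₗ LinearMap.mulLeft K (∏ j, (X - C (z j)) ^ (Λ j * a / q)) ∘ₗ
        (degreeLT K d).subtype)
      fun g => (h.mem_regularFormsOfType_iff ha hd _).mpr ⟨g, mem_degreeLT.mp g.2, rfl⟩) (by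
    constructor
    · intro f g hfg
      have h1 := h.polyForm_injective a (congrArg Subtype.val hfg)
      exact Subtype.ext (mul_left_cancel₀ (prod_monic z fun j => Λ j * a / q).ne_zero h1)
    · rintro ⟨ω, hω⟩
      obtain ⟨g, hg, rfl⟩ := (h.mem_regularFormsOfType_iff ha hd _).mp hω
      exact ⟨⟨g, mem_degreeLT.mpr hg⟩, rfl⟩)

theorem finite_regularFormsOfType (h : IsSuperelliptic p q k z Λ y) (ha : 1 ≤ a ∧ a < q)
    (hd : a * k = (∑ j, Λ j * a / q) + d) : Module.Finite K (regularFormsOfType K L y a) :=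
  Module.Finite.equiv ((degreeLTEquiv K d).symm.trans (h.degreeLTEquivForms ha hd))

theorem finrank_regularFormsOfType (h : IsSuperelliptic p q k z Λ y) (ha : 1 ≤ a ∧ a < q)
    (hd : a * k = (∑ j, Λ j * a / q) + d) :
    Module.finrank K (regularFormsOfType K L y a) = d := by
  rw [← ((degreeLTEquiv K d).symm.trans (h.degreeLTEquivForms ha hd)).finrank_eq,
    Module.finrank_fin_fun]

theorem exists_polyForm_eq (h : IsSuperelliptic p q k z Λ y) (ha : 1 ≤ a ∧ a < q)
    (hd : a * k = (∑ j, Λ j * a / q) + d) (ω : regularFormsOfType K L y a) :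
    ∃ U : K[X], polyForm y a U = ω ∧ U.degree < (a * k : ℕ) := by
  obtain ⟨g, hg, h1⟩ := (h.mem_regularFormsOfType_iff ha hd _).mp ω.2
  exact ⟨_, h1, (degree_prod_mul_lt_iff hd g).mpr hg⟩

/-- The polynomial `U` of the regular differential `U(x) dx / y ^ a`. -/
noncomputable def numerator (h : IsSuperelliptic p q k z Λ y) (ha : 1 ≤ a ∧ a < q)
    (hd : a * k = (∑ j, Λ j * a / q) + d) : regularFormsOfType K L y a →ₗ[K] K[X] :=
  (LinearEquiv.ofInjective (polyForm y a) (h.polyForm_injective a)).symm.toLinearMap ∘ₗ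
    Submodule.inclusion fun ω hω => by
      obtain ⟨U, hU, -⟩ := h.exists_polyForm_eq ha hd ⟨ω, hω⟩
      exact ⟨U, hU⟩

theorem polyForm_numerator (h : IsSuperelliptic p q k z Λ y) (ha : 1 ≤ a ∧ a < q)
    (hd : a * k = (∑ j, Λ j * a / q) + d) (ω : regularFormsOfType K L y a) :
    polyForm y a (h.numerator ha hd ω) = ω := by
  have := (LinearEquiv.ofInjective (polyForm y a) (h.polyForm_injective a)).apply_symm_apply
    (Submodule.inclusion (fun ω hω => by
      obtain ⟨U, hU, -⟩ := h.exists_polyForm_eq ha hd ⟨ω, hω⟩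
      exact ⟨U, hU⟩) ω)
  exact congrArg Subtype.val this

theorem numerator_eq (h : IsSuperelliptic p q k z Λ y) (ha : 1 ≤ a ∧ a < q)
    (hd : a * k = (∑ j, Λ j * a / q) + d) {ω : regularFormsOfType K L y a} {U : K[X]}
    (hU : (ω : Ω[L⁄K]) = polyForm y a U) : h.numerator ha hd ω = U :=
  h.polyForm_injective a (by rw [h.polyForm_numerator, hU])

theorem degree_numerator_lt (h : IsSuperelliptic p q k z Λ y) (ha : 1 ≤ a ∧ a < q)
    (hd : a * k = (∑ j, Λ j * a / q) + d) (ω : regularFormsOfType K L y a) :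
    (h.numerator ha hd ω).degree < (a * k : ℕ) := by
  obtain ⟨U, hU, hdeg⟩ := h.exists_polyForm_eq ha hd ω
  rwa [h.numerator_eq ha hd hU.symm]

/-- The functional `∑ u_i x ^ i dx / y ^ a ↦ u_m` on `Ω¹_a(X)`. -/
noncomputable def coordForm (h : IsSuperelliptic p q k z Λ y) (ha : 1 ≤ a ∧ a < q)
    (hd : a * k = (∑ j, Λ j * a / q) + d) (m : ℕ) :
    Module.Dual K (regularFormsOfType K L y a) :=
  lcoeff K m ∘ₗ h.numerator ha hd

theorem coordForm_eq (h : IsSuperelliptic p q k z Λ y) (ha : 1 ≤ a ∧ a < q)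
    (hd : a * k = (∑ j, Λ j * a / q) + d) (m : ℕ) {ω : regularFormsOfType K L y a} {U : K[X]}
    (hU : (ω : Ω[L⁄K]) = polyForm y a U) : h.coordForm ha hd m ω = U.coeff m :=
  congrArg (fun U => U.coeff m) (h.numerator_eq ha hd hU)

theorem eq_sum_coordForm (h : IsSuperelliptic p q k z Λ y) (ha : 1 ≤ a ∧ a < q)
    (hd : a * k = (∑ j, Λ j * a / q) + d) (ω : regularFormsOfType K L y a) :
    (ω : Ω[L⁄K]) = ∑ m : Fin (a * k),
      h.coordForm ha hd m ω • diffForm K L y a (RatFunc.X ^ (m : ℕ)) := by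
  conv_lhs => rw [← h.polyForm_numerator ha hd ω,
    polyForm_eq_sum y a (h.degree_numerator_lt ha hd ω)]
  rfl

/-- The coordinates jointly embed `Ω¹_a(X)` into `K ^ (a k)`, so every functional extends. The
expansion is not unique in general, the dimension being only `d`. -/
theorem exists_eq_sum_coordForm (h : IsSuperelliptic p q k z Λ y) (ha : 1 ≤ a ∧ a < q)
    (hd : a * k = (∑ j, Λ j * a / q) + d) (ξ : Module.Dual K (regularFormsOfType K L y a)) :
    ∃ b : Fin (a * k) → K, ξ = ∑ m, b m • h.coordForm ha hd m := by
  let f : regularFormsOfType K L y a →ₗ[K] Fin (a * k) → K :=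
    LinearMap.pi fun m => h.coordForm ha hd m
  have hf : Function.Injective f := by
    intro ω η hωη
    apply Subtype.ext
    rw [h.eq_sum_coordForm ha hd ω, h.eq_sum_coordForm ha hd η]
    exact Finset.sum_congr rfl fun m _ => congrArg (· • _) (congrFun hωη m)
  obtain ⟨η, rfl⟩ := LinearMap.dualMap_surjective_of_injective hf ξ
  refine ⟨fun m => η (Pi.single m 1), LinearMap.ext fun ω => ?_⟩
  rw [LinearMap.dualMap_apply, LinearMap.pi_apply_eq_sum_univ η (f ω), LinearMap.sum_apply]
  refine Finset.sum_congr rfl fun m _ => ?_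
  rw [LinearMap.smul_apply, smul_eq_mul, smul_eq_mul, mul_comm]
  congr 2
  ext i
  simp [Pi.single_apply, eq_comm]

end IsSuperelliptic

/-! ### `p`-th powers in `𝔽_p[z]` -/

section PolyZp

variable {p n : ℕ} [Fact p.Prime]

theorem pow_mem_PolyZp (f : MvPolynomial (Fin n) (ZMod p)) : f ^ p ∈ PolyZp p n := by
  induction f using MvPolynomial.induction_on with
  | C a =>
    rw [← map_pow, ZMod.pow_card]
    exact Subalgebra.algebraMap_mem _ a
  | add f g hf hg =>
    rw [add_pow_char]
    exact add_mem hf hg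
  | mul_X f i hf =>
    rw [mul_pow]
    exact mul_mem hf (Algebra.subset_adjoin ⟨i, rfl⟩)

theorem exists_pow_eq_of_mem_PolyZp {f : MvPolynomial (Fin n) (ZMod p)} (hf : f ∈ PolyZp p n) :
    ∃ g, g ^ p = f := by
  induction hf using Algebra.adjoin_induction with
  | mem f hf =>
    obtain ⟨i, rfl⟩ := hf
    exact ⟨MvPolynomial.X i, rfl⟩
  | algebraMap a => exact ⟨MvPolynomial.C a, by rw [← map_pow, ZMod.pow_card]; rfl⟩
  | add f g _ _ hf hg =>
    obtain ⟨f, rfl⟩ := hf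
    obtain ⟨g, rfl⟩ := hg
    exact ⟨f + g, add_pow_char _ _ _⟩
  | mul f g _ _ hf hg =>
    obtain ⟨f, rfl⟩ := hf
    obtain ⟨g, rfl⟩ := hg
    exact ⟨f * g, mul_pow _ _ _⟩

end PolyZp

/-! ### The curve over `𝕂(z)` -/

section Curve

variable {p q n : ℕ} [Fact p.Prime]

theorem toK_injective : Function.Injective (toK p n) :=
  (RingHom.injective (PerfectClosure.of (FractionRing (MvPolynomial (Fin n) (ZMod p))) p)).comp
    (IsFractionRing.injective _ _)

variable (p n) in
/-- The branch points `z_j ∈ 𝕂(z)`. -/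
noncomputable def branch (j : Fin n) : FieldK p n := toK p n (MvPolynomial.X j)

theorem branch_injective : Function.Injective (branch p n) :=
  toK_injective.comp (MvPolynomial.X_injective)

theorem xSub_eq (j : Fin n) :
    xSub p j = algebraMap (FieldK p n)[X] (RatFunc (FieldK p n)) (X - C (branch p n j)) := by
  rw [map_sub, RatFunc.algebraMap_X, RatFunc.algebraMap_C]
  rfl

theorem isSuperelliptic {k : ℕ} [Fact q.Prime] (hqp : q < p) (hk : 0 < k) {Λ : Fin n → ℕ}
    (hΛ : ∀ j, 0 < Λ j ∧ Λ j < q) (hsum : ∑ j, Λ j = k * q + 1) :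
    IsSuperelliptic p q k (branch p n) Λ (coordY p q Λ) where
  prime := Fact.out
  lt := hqp
  pos := hk
  injective := branch_injective
  bounds := hΛ
  sum_eq := hsum
  adjoin_eq_top := by
    let S := IntermediateField.adjoin (RatFunc (FieldK p n)) {rootY p q Λ}
    change IntermediateField.adjoin (RatFunc (FieldK p n))
      {IntermediateField.AdjoinSimple.gen (RatFunc (FieldK p n)) (rootY p q Λ)} =
        (⊤ : IntermediateField (RatFunc (FieldK p n)) S)
    refine IntermediateField.map_injective S.val ?_
    rw [IntermediateField.adjoin_map, Set.image_singleton]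
    change S = _
    rw [← AlgHom.fieldRange_eq_map, IntermediateField.fieldRange_val]
  pow_eq := by
    rw [coordY_pow, curvePoly]
    congr 1
    rw [map_prod]
    exact Finset.prod_congr rfl fun i _ => by rw [map_pow, xSub_eq]

variable (p) in
/-- The polynomial with the coefficients `P_j^{lp+p-1}(z, M)`. -/
noncomputable def solPoly (M : Fin n → ℕ) (j : Fin n) : (FieldK p n)[X] :=
  decim p ((∏ i, (X - C (branch p n i)) ^ M i) /ₘ (X - C (branch p n j)))

theorem toK_solVec (M : Fin n → ℕ) (l : ℕ) (j : Fin n) :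
    toK p n (solVec p M (l * p + p - 1) j) = (solPoly p M j).coeff l := by
  rw [solVec_eq_coeff_decim, ← coeff_map (toK p n) l, ← decim_map (Fact.out : p.Prime).pos,
    map_divByMonic _ (monic_X_sub_C _), Polynomial.map_prod]
  simp only [Polynomial.map_pow, Polynomial.map_sub, map_X, map_C]
  rfl

/-- The module of solutions is spanned by finitely many solution vectors. -/
theorem solModule_eq_span_fin {M : Fin n → ℕ} (hM : ∀ i, 0 < M i) {N : ℕ}
    (hN : ∑ i, M i < N * p + p) : solModule p M =
      Submodule.span (PolyZp p n) (Set.range fun l : Fin N => solVec p M (l * p + p - 1)) := by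
  rw [solModule_eq_span]
  refine le_antisymm (Submodule.span_le.mpr ?_) (Submodule.span_mono ?_)
  · rintro _ ⟨l, rfl⟩
    by_cases hl : l < N
    · exact Submodule.subset_span ⟨⟨l, hl⟩, rfl⟩
    · have : solVec p M (l * p + p - 1) = 0 := by
        rw [solVec_eq_coeff_decim]
        ext1 j
        refine coeff_decim_divByMonic_eq_zero _ hM j (hN.trans_le ?_)
        have := Nat.mul_le_mul_right p (not_lt.mp hl)
        omega
      simp only [this]
      exact Submodule.zero_mem _
  · rintro _ ⟨l, rfl⟩
    exact ⟨l, rfl⟩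

/-- A relation over `𝔽_p[z ^ p]` becomes a relation over `𝕂(z)`, where surjectivity of the Cartier
operator excludes it. -/
theorem linearIndependent_solVec {m : Fin n → ℕ} (hm : ∀ i, 0 < m i ∧ m i < p) {d : ℕ}
    (hd : d * p ≤ ∑ i, m i) :
    LinearIndependent (PolyZp p n) fun l : Fin d => solVec p m (l * p + p - 1) := by
  rw [Fintype.linearIndependent_iff]
  intro c hc l
  have h1 := eq_zero_of_sum_coeff_decim_eq_zero (p := p) (branch_injective (p := p) (n := n))
    (fun i => ⟨(hm i).1, (hm i).2.le⟩) hd (fun l => toK p n (c l)) (fun j => by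
      have h2 := congrArg (toK p n) (congrFun hc j)
      rw [Finset.sum_apply, map_sum, Pi.zero_apply, map_zero] at h2
      rw [← h2]
      refine Finset.sum_congr rfl fun l _ => ?_
      rw [Pi.smul_apply, Subalgebra.smul_def, smul_eq_mul, map_mul, toK_solVec]
      rfl)
  have h2 := congrFun h1 l
  exact Subtype.ext (toK_injective (h2.trans (map_zero _).symm))

/-- Decimation turns the surplus exponent `p e_i` into `(x - z_i ^ p) ^ e_i`, and the inverse
Frobenius turns this into `(x - z_i) ^ e_i`, exactly the vanishing that regularity requires. -/
theorem solPoly_tildeM [Fact q.Prime] {Λ : Fin n → ℕ} {a : ℕ} (hqp : q < p)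
    (hΛ : ∀ j, 0 < Λ j ∧ Λ j < q) (ha : 1 ≤ a ∧ a < q) (hap : q ∣ a * p - 1) (j : Fin n) :
    (solPoly p (tildeM p q Λ a) j).map (invFrobenius (FieldK p n) p) =
      (∏ j, (X - C (branch p n j)) ^ (Λ j * a / q)) *
        (solPoly p (reducedM p q Λ a) j).map (invFrobenius (FieldK p n) p) := by
  have h := tildeM_eq_reducedM_add (Fact.out : q.Prime) hqp hΛ ha hap
  have h1 : tildeM p q Λ a = fun i => reducedM p q Λ a i + p * (Λ i * a / q) :=
    funext fun i => (h i).2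
  rw [h1, solPoly, decim_divByMonic_add _ _ fun i => (h i).1.1, Polynomial.map_mul,
    Polynomial.map_prod]
  congr 1
  refine Finset.prod_congr rfl fun i _ => ?_
  rw [Polynomial.map_pow, Polynomial.map_sub, map_X, map_C]
  congr 3
  exact frobeniusEquiv_symm_apply_frobenius (FieldK p n) p (branch p n i)

end Curve

/-- The semilinear map with prescribed values on a basis. -/
noncomputable def semilinearConstr {K W V ι : Type*} [Field K] [AddCommGroup W] [Module K W]
    [AddCommGroup V] [Module K V] [Fintype ι] (σ : K →+* K) (b : Module.Basis ι K W) (v : ι → V) :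
    W →ₛₗ[σ] V where
  toFun x := ∑ i, σ (b.repr x i) • v i
  map_add' x y := by
    rw [← Finset.sum_add_distrib]
    exact Finset.sum_congr rfl fun i _ => by rw [map_add, Finsupp.add_apply, map_add, add_smul]
  map_smul' c x := by
    rw [Finset.smul_sum]
    exact Finset.sum_congr rfl fun i _ => by
      rw [map_smul, Finsupp.smul_apply, smul_eq_mul, map_mul, mul_smul]

theorem semilinearConstr_basis {K W V ι : Type*} [Field K] [AddCommGroup W] [Module K W]
    [AddCommGroup V] [Module K V] [Fintype ι] (σ : K →+* K) (b : Module.Basis ι K W) (v : ι → V)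
    (j : ι) : semilinearConstr σ b v (b j) = v j := by
  classical
  change ∑ i, σ (b.repr (b j) i) • v i = v j
  rw [Finset.sum_eq_single j]
  · simp
  · intro i _ hij
    rw [b.repr_self, Finsupp.single_eq_of_ne hij, map_zero, zero_smul]
  · simp

theorem free_of_eq_span {R M : Type*} [CommRing R] [Nontrivial R] [AddCommGroup M] [Module R M]
    {d : ℕ} {v : Fin d → M} (hv : LinearIndependent R v) {S : Submodule R M}
    (hS : S = Submodule.span R (Set.range v)) :
    Module.Finite R S ∧ Module.Free R S ∧ Module.finrank R S = d := by
  subst hS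
  have b := Module.Basis.span hv
  exact ⟨Module.Finite.of_basis b, Module.Free.of_basis b,
    by rw [Module.finrank_eq_card_basis b, Fintype.card_fin]⟩

/-! ### Surjectivity of the Cartier map -/

section Cartier

variable {p q k n a d : ℕ} [Fact p.Prime] [Fact q.Prime] {Λ : Fin n → ℕ}

theorem degree_solPoly_lt {M : Fin n → ℕ} (hM : ∀ i, 0 < M i) {N : ℕ}
    (hN : ∑ i, M i < N * p + p) (j : Fin n) : (solPoly p M j).degree < N := by
  refine (degree_lt_iff_coeff_zero _ _).mpr fun l hl => ?_
  refine coeff_decim_divByMonic_eq_zero _ hM j (hN.trans_le ?_)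
  have := Nat.mul_le_mul_right p hl
  omega

theorem span_solPoly {m : Fin n → ℕ} (hm : ∀ i, 0 < m i ∧ m i < p)
    (hd : d * p ≤ ∑ i, m i) {g : (FieldK p n)[X]} (hg : g.degree < d) :
    ∃ c : Fin n → FieldK p n,
      ∑ j, C (c j) * (solPoly p m j).map (invFrobenius (FieldK p n) p) = g := by
  -- Solve for the Frobenius twist of `g`, then untwist both sides with the inverse Frobenius.
  obtain ⟨b, hb⟩ := exists_sum_decim_eq (p := p) (branch_injective (p := p) (n := n))
    (fun i => ⟨(hm i).1, (hm i).2.le⟩) (g.map (frobenius (FieldK p n) p)) (by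
      intro l hl
      rw [coeff_map, coeff_eq_zero_of_degree_lt (hg.trans_le _), map_zero]
      rw [Nat.cast_le]
      by_contra! h
      have := Nat.mul_le_mul_right p h
      rw [Nat.succ_mul] at this
      omega)
  refine ⟨fun j => invFrobenius (FieldK p n) p (b j), ?_⟩
  have h1 := congrArg (Polynomial.map (invFrobenius (FieldK p n) p)) hb
  rw [Polynomial.map_sum, Polynomial.map_map] at h1
  have h2 : (invFrobenius (FieldK p n) p).comp (frobenius (FieldK p n) p) = RingHom.id _ :=
    RingHom.ext fun c => frobeniusEquiv_symm_apply_frobenius (FieldK p n) p c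
  rw [h2, Polynomial.map_id] at h1
  rw [← h1]
  exact Finset.sum_congr rfl fun j _ => by rw [Polynomial.map_mul, map_C]; rfl

/-- Surjectivity of the Cartier map. -/
theorem span_cartier_eq_top (hX : IsSuperelliptic p q k (branch p n) Λ (coordY p q Λ))
    (hqp : q < p) (hΛ : ∀ j, 0 < Λ j ∧ Λ j < q) (ha : 1 ≤ a ∧ a < q) (hap : q ∣ a * p - 1)
    (hd : a * k = (∑ j, Λ j * a / q) + d) (hdp : d * p ≤ ∑ j, reducedM p q Λ a j)
    {ω : Fin n → OmegaA p q Λ a}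
    (hω : ∀ j, (ω j : Forms p q Λ) = polyForm (coordY p q Λ) a
      ((solPoly p (tildeM p q Λ a) j).map (invFrobenius (FieldK p n) p))) :
    Submodule.span (FieldK p n) (Set.range ω) = ⊤ := by
  refine top_unique fun η _ => ?_
  obtain ⟨g, hg, hη⟩ := (hX.mem_regularFormsOfType_iff ha hd _).mp η.2
  obtain ⟨c, hc⟩ := span_solPoly
    (fun j => (tildeM_eq_reducedM_add Fact.out hqp hΛ ha hap j).1) hdp hg
  refine (Submodule.mem_span_range_iff_exists_fun _).mpr ⟨c, Subtype.ext ?_⟩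
  rw [← hη, ← hc, Finset.mul_sum, map_sum, Submodule.coe_sum]
  refine Finset.sum_congr rfl fun j _ => ?_
  rw [Submodule.coe_smul, hω, solPoly_tildeM hqp hΛ ha hap, mul_left_comm, ← smul_eq_C_mul,
    map_smul]

end Cartier

end ArithKZ

/-! ### The Cartier map, its adjoint and the rank -/

open ArithKZ in
theorem theorem7p3 (p q k n : ℕ) [Fact p.Prime] [Fact q.Prime]
    (hqp : q < p) (hk : 0 < k) (hp : k * q + 1 < p)
    (Λ : Fin n → ℕ) (hΛ : ∀ j, 0 < Λ j ∧ Λ j < q) (hsum : ∑ j, Λ j = k * q + 1)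
    (a₁ : ℕ) (ha₁ : 1 ≤ a₁ ∧ a₁ < q) (ha₁p : q ∣ a₁ * p - 1) :
    ∃ (w : Module.Basis (Fin n) (FieldK p n) (SpaceW p q Λ))
      (C : SpaceW p q Λ →ₛₗ[invFrobenius (FieldK p n) p] OmegaA p q Λ a₁)
      (φ : Fin (a₁ * k) → Module.Dual (FieldK p n) (OmegaA p q Λ a₁)),
      -- `w` is the basis `dx / (y (x - z_j))` of `W(X)`
      (∀ j, (w j : Forms p q Λ) = form p q Λ 1 (xSub p j)⁻¹) ∧
      -- `C` is the Cartier map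
      (∀ j, (C (w j) : Forms p q Λ) = ∑ l : Fin (a₁ * k),
        invFrobenius (FieldK p n) p (toK p n (solVec p (tildeM p q Λ a₁) (l * p + p - 1) j)) •
          form p q Λ a₁ (RatFunc.X ^ (l : ℕ))) ∧
      -- `φ m` is the functional `∑ u_i x ^ i dx / y ^ a₁ ↦ u_m`, and every element of
      -- `Ω¹_{a₁}(X)` is of the form `∑ u_i x ^ i dx / y ^ a₁` with `i < a₁ k`
      (∀ (m : Fin (a₁ * k)) (u : Polynomial (FieldK p n))
        (h : form p q Λ a₁ (algebraMap _ _ u) ∈ OmegaA p q Λ a₁), φ m ⟨_, h⟩ = u.coeff m) ∧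
      (∀ ω : OmegaA p q Λ a₁, (ω : Forms p q Λ) =
        ∑ m : Fin (a₁ * k), φ m ω • form p q Λ a₁ (RatFunc.X ^ (m : ℕ))) ∧
      -- the adjoint of `C` sends `φ m` to the arithmetic solution `P^{mp+p-1}(z, M̃)`
      (∀ m : Fin (a₁ * k), w.dualBasis.equivFun (adjointMap p C (φ m)) =
        fun j => toK p n (solVec p (tildeM p q Λ a₁) (m * p + p - 1) j)) ∧
      -- the adjoint of `C` is an isomorphism onto the `𝕂(z)`-span of the arithmetic solutions
      Function.Injective (adjointMap p C) ∧
      (∀ M : Fin n → ℕ, IsAdmissible p q Λ M →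
        Set.range (fun ξ => w.dualBasis.equivFun (adjointMap p C ξ)) =
          (Submodule.span (FieldK p n)
            ((fun v j => toK p n (v j)) '' (solModule p M : Set (Fin n → _))) : Set (Fin n → _))) ∧
      -- it maps the `𝔽_p[z]`-span of the `φ m` bijectively to the module of arithmetic solutions
      (∀ M : Fin n → ℕ, IsAdmissible p q Λ M →
        Set.BijOn (fun ξ => w.dualBasis.equivFun (adjointMap p C ξ))
          (Set.range fun c : Fin (a₁ * k) → MvPolynomial (Fin n) (ZMod p) =>
            ∑ m, toK p n (c m) • φ m)
          ((fun v j => toK p n (v j)) '' (solModule p M : Set (Fin n → _)))) ∧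
      IsAdmissible p q Λ (tildeM p q Λ a₁) ∧
      -- both sides have dimension `a₁ k - e(a₁)`
      Module.Finite (FieldK p n) (Module.Dual (FieldK p n) (OmegaA p q Λ a₁)) ∧
      (Module.finrank (FieldK p n) (Module.Dual (FieldK p n) (OmegaA p q Λ a₁)) : ℤ) =
        a₁ * k - eSum q Λ a₁ ∧
      (∀ M : Fin n → ℕ, IsAdmissible p q Λ M →
        Module.Finite (PolyZp p n) (solModule p M) ∧
        Module.Free (PolyZp p n) (solModule p M) ∧
        (Module.finrank (PolyZp p n) (solModule p M) : ℤ) = a₁ * k - eSum q Λ a₁) := by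
  have hq : q.Prime := Fact.out
  have hX := isSuperelliptic (n := n) hqp hk hΛ hsum
  obtain ⟨d, r, hd, hsumM, hr⟩ := sum_reducedM hq hqp hp hΛ hsum ha₁ ha₁p
  have hred := tildeM_eq_reducedM_add hq hqp hΛ ha₁ ha₁p
  have hadm := tildeM_isAdmissible hq hqp hΛ ha₁ ha₁p
  -- In fact `∑ M̃_j = a₁ k p + r` with `r < p`, so only the indices `l < a₁ k` carry nonzero
  -- solution vectors.
  have hN : ∑ j, tildeM p q Λ a₁ j < (a₁ * k) * p + p := by
    have h1 : ∑ j, tildeM p q Λ a₁ j =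
        ∑ j, reducedM p q Λ a₁ j + p * ∑ j, Λ j * a₁ / q := by
      rw [Finset.mul_sum, ← Finset.sum_add_distrib]
      exact Finset.sum_congr rfl fun j _ => (hred j).2
    rw [h1, hsumM, hd, add_mul, mul_comm p]
    omega
  have hdeg := degree_solPoly_lt (fun i => (hadm i).1) hN
  set T : Fin n → Polynomial (FieldK p n) := fun j =>
    (solPoly p (tildeM p q Λ a₁) j).map (invFrobenius (FieldK p n) p) with hT
  have hTdeg : ∀ j, (T j).degree < (a₁ * k : ℕ) := fun j =>
    (Polynomial.degree_map_le).trans_lt (hdeg j)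
  have hTmem : ∀ j, polyForm (coordY p q Λ) a₁ (T j) ∈ OmegaA p q Λ a₁ := fun j => by
    have h1 := solPoly_tildeM hqp hΛ ha₁ ha₁p j
    refine (hX.mem_regularFormsOfType_iff ha₁ hd _).mpr ⟨_, ?_, congrArg _ h1.symm⟩
    rw [← IsSuperelliptic.degree_prod_mul_lt_iff hd, ← h1]
    exact hTdeg j
  let ω : Fin n → OmegaA p q Λ a₁ := fun j => ⟨_, hTmem j⟩
  have hω := span_cartier_eq_top hX hqp hΛ ha₁ ha₁p hd (by omega) (ω := ω) fun j => rfl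
  have hli : LinearIndependent (FieldK p n) fun j : Fin n => form p q Λ 1 (xSub p j)⁻¹ := by
    simp only [xSub_eq]
    exact hX.linearIndependent_diffForm_inv 1
  let w : Module.Basis (Fin n) (FieldK p n) (SpaceW p q Λ) := Module.Basis.span hli
  let c : SpaceW p q Λ →ₛₗ[invFrobenius (FieldK p n) p] OmegaA p q Λ a₁ :=
    semilinearConstr _ w ω
  have hc : ∀ j, c (w j) = ω j := semilinearConstr_basis _ w ω
  let φ : Fin (a₁ * k) → Module.Dual (FieldK p n) (OmegaA p q Λ a₁) := fun m =>
    hX.coordForm ha₁ hd m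
  have hsurj : Function.Surjective (frobenius (FieldK p n) p) :=
    (PerfectRing.bijective_frobenius (R := FieldK p n) (p := p)).2
  have : RingHomSurjective (frobenius (FieldK p n) p) := ⟨hsurj⟩
  let J : Module.Dual (FieldK p n) (OmegaA p q Λ a₁) →ₛₗ[frobenius (FieldK p n) p]
      (Fin n → FieldK p n) := w.dualBasis.equivFun.toLinearMap.comp (adjointMap p c)
  have hJ : ∀ ξ j, J ξ j = frobenius (FieldK p n) p (ξ (ω j)) := fun ξ j => by
    change w.dualBasis.equivFun (adjointMap p c ξ) j = _
    rw [Module.Basis.dualBasis_equivFun, ← hc]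
    rfl
  have hJφ : ∀ m : Fin (a₁ * k), J (φ m) = fun j =>
      toK p n (solVec p (tildeM p q Λ a₁) (m * p + p - 1) j) := fun m => by
    ext j
    rw [hJ, hX.coordForm_eq ha₁ hd m (U := T j) rfl, Polynomial.coeff_map, toK_solVec]
    exact frobenius_apply_frobeniusEquiv_symm (FieldK p n) p _
  -- Injectivity of the adjoint is dual to surjectivity of the Cartier map: a functional is
  -- determined on the spanning family `ω`.
  have hJinj : Function.Injective J := by
    intro ξ η h
    refine LinearMap.ext_on hω ?_
    rintro _ ⟨j, rfl⟩
    have h1 := congrFun h j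
    rw [hJ, hJ] at h1
    exact (frobenius (FieldK p n) p).injective h1
  have hmod : ∀ M, IsAdmissible p q Λ M → solModule p M = Submodule.span (PolyZp p n)
      (Set.range fun l : Fin (a₁ * k) => solVec p (tildeM p q Λ a₁) (l * p + p - 1)) := fun M hM => by
    rw [solModule_eq_of_isAdmissible hM hadm, solModule_eq_span_fin (fun i => (hadm i).1) hN]
  have hJsum : ∀ b : Fin (a₁ * k) → MvPolynomial (Fin n) (ZMod p),
      J (∑ m, toK p n (b m) • φ m) = fun j => toK p n
        ((∑ m, (⟨b m ^ p, pow_mem_PolyZp _⟩ : PolyZp p n) •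
          solVec p (tildeM p q Λ a₁) (m * p + p - 1)) j) := fun b => by
    ext j
    rw [map_sum, Finset.sum_apply, Finset.sum_apply, map_sum]
    refine Finset.sum_congr rfl fun m _ => ?_
    rw [LinearMap.map_smulₛₗ, hJφ, Pi.smul_apply, Pi.smul_apply, Subalgebra.smul_def, smul_eq_mul,
      smul_eq_mul, map_mul, map_pow]
    rfl
  refine ⟨w, c, φ, fun j => congrArg Subtype.val (Module.Basis.span_apply hli j), fun j => ?_,
    fun m u h => hX.coordForm_eq ha₁ hd m rfl, fun ξ => hX.eq_sum_coordForm ha₁ hd ξ, hJφ,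
    fun ξ η h => hJinj (congrArg w.dualBasis.equivFun h), fun M hM => ?_, fun M hM => ⟨?_, ?_, ?_⟩,
    hadm, ?_, ?_, fun M hM => ?_⟩
  · rw [hc]
    change polyForm (coordY p q Λ) a₁ (T j) = _
    rw [polyForm_eq_sum _ _ (hTdeg j)]
    refine Finset.sum_congr rfl fun l _ => ?_
    rw [toK_solVec, hT, Polynomial.coeff_map]
    rfl
  · rw [hmod M hM]
    change Set.range J = _
    apply subset_antisymm
    · rintro _ ⟨ξ, rfl⟩
      obtain ⟨b, rfl⟩ := hX.exists_eq_sum_coordForm ha₁ hd ξ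
      rw [map_sum]
      refine Submodule.sum_mem _ fun m _ => ?_
      rw [LinearMap.map_smulₛₗ]
      refine Submodule.smul_mem _ _ (Submodule.subset_span ⟨_, Submodule.subset_span ⟨m, rfl⟩, ?_⟩)
      exact (hJφ m).symm
    · change _ ≤ LinearMap.range J
      rw [Submodule.span_le]
      rintro _ ⟨v, hv, rfl⟩
      induction hv using Submodule.span_induction with
      | mem v hv =>
        obtain ⟨m, rfl⟩ := hv
        exact ⟨φ m, hJφ m⟩
      | zero =>
        exact (congrArg (· ∈ LinearMap.range J) (funext fun j => map_zero (toK p n))).mpr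
          (zero_mem _)
      | add u v _ _ hu hv =>
        exact (congrArg (· ∈ LinearMap.range J)
          (funext fun j => map_add (toK p n) (u j) (v j))).mpr (add_mem hu hv)
      | smul b v _ hv =>
        exact (congrArg (· ∈ LinearMap.range J)
          (funext fun j => map_mul (toK p n) (b : MvPolynomial (Fin n) (ZMod p)) (v j))).mpr
          (Submodule.smul_mem _ (toK p n b) hv)
  · rintro _ ⟨b, rfl⟩
    refine ⟨_, ?_, (hJsum b).symm⟩
    rw [hmod M hM]
    exact Submodule.sum_mem _ fun m _ => Submodule.smul_mem _ _ (Submodule.subset_span ⟨m, rfl⟩)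
  · exact hJinj.injOn
  · rintro _ ⟨v, hv, rfl⟩
    rw [hmod M hM] at hv
    obtain ⟨b, rfl⟩ := (Submodule.mem_span_range_iff_exists_fun _).mp hv
    -- The adjoint raises coefficients to the `p`-th power, so surjectivity uses that every element
    -- of `𝔽_p[z ^ p]` is the `p`-th power of a polynomial.
    choose g hg using fun m => exists_pow_eq_of_mem_PolyZp (b m).2
    refine ⟨_, ⟨g, rfl⟩, (hJsum g).trans ?_⟩
    have : b = fun m => (⟨g m ^ p, pow_mem_PolyZp _⟩ : PolyZp p n) :=
      funext fun m => Subtype.ext (hg m).symm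
    rw [this]
  · have := hX.finite_regularFormsOfType ha₁ hd
    infer_instance
  · rw [Subspace.dual_finrank_eq, hX.finrank_regularFormsOfType ha₁ hd, eSum_eq hq, ← Nat.cast_mul,
      hd]
    push_cast
    ring
  -- The rank is read off from the reduced exponents: from `d p ≤ ∑ m_j < d p + p`, the first `d`
  -- solution vectors are both independent and spanning, unlike the `a₁ k` generators obtained from
  -- `M̃`, which may be dependent.
  · have h1 : solModule p M = Submodule.span (PolyZp p n)
        (Set.range fun l : Fin d => solVec p (reducedM p q Λ a₁) (l * p + p - 1)) := by
      rw [solModule_eq_of_isAdmissible hM (reducedM_isAdmissible hq hqp hΛ ha₁ ha₁p),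
        solModule_eq_span_fin (N := d) (fun i => (hred i).1.1) (by omega)]
    obtain ⟨h2, h3, h4⟩ := free_of_eq_span
      (linearIndependent_solVec (d := d) (fun i => (hred i).1) (by omega)) h1
    refine ⟨h2, h3, ?_⟩
    rw [h4, eSum_eq hq, ← Nat.cast_mul, hd]
    push_cast
    ring
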